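/- **Setting.** Let $\Omega=(0,1)^2$, cut into a uniform triangulation: $N_h\ge 1$ partitions on each side, each of the $N_h^2$ square cells being halved along one of its diagonals. For $k\in\mathbb N$ let $V_h^k$ be the space of continuous functions on $\overline\Omega$ that are polynomials of degree $\le k$ on each triangle. Let $l,q,m\ge1$, let $\emptyset\ne\Gamma_D\subseteq\partial\Omega$ (for $\Gamma_D=\partial\Omega$ the temperature space below is $H^1_0(\Omega)\cap V_h^q$), and put $$Y_h=(H_0^1(\Omega)\cap V_h^l)^2,\quad \Theta_h=\{\theta\in V_h^q:\theta|_{\Gamma_D}=0\},\quad M_h=L^2_0(\Omega)\cap V_h^m,\quad X_h=Y_h\times\Theta_h\times M_h,$$ $$\|U\|_X^2=\|\nabla \mathbf u\|_{L^2}^2+\|\nabla\theta\|_{L^2}^2+\|p\|_{L^2}^2\qquad (U=(\mathbf u,\theta,p)).$$ Let $\Pi_h$ denote linear operators from $Y_h$ and $\Theta_h$ to the corresponding spaces of degrees $l-1$ and $q-1$ (with the same boundary conditions), and $\Pi_h^*=\mathrm{Id}-\Pi_h$. Let $Pr>0$, $C_S\in\mathbb R$, and let $\phi\in C_c^\infty(\mathbb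 R)$ be even, nonnegative and not identically zero, with support in $(-1,1)$; $\phi_n(x)=n\,\phi(nx)/\|\phi\|_{L^1}$, $n\ge1$. A parameter is a pair $\mu=(\mu_{ph},\mu_g)$ with $\mu_g>0$. For a vector field $\mathbf w$ put $$|\nabla\mathbf w|_{\mu_g}=\Big((\partial_xw_1)^2+\mu_g^{-2}(\partial_yw_1)^2+(\partial_xw_2)^2+\mu_g^{-2}(\partial_yw_2)^2\Big)^{1/2},$$ $$\nu_T(\mathbf w)=C_S^2\tfrac{\mu_g^2+1}{N_h^2}\,|\nabla\mathbf w|_{\mu_g},\qquad \nu_{T,n}(\mathbf w)=C_S^2\tfrac{\mu_g^2+1}{N_h^2}\,(\phi_n*|\cdot|)\big(|\nabla\mathbf w|_{\mu_g}\big),$$ where $\phi_n*|\cdot|$ is the convolution on $\mathbb R$ of $\phi_n$ with the absolute value. For $U=(\mathbf u,\theta,p)$ and $V=(\mathbf v,\eta,r)$ in $X_h$ let $$\begin{aligned}A(U,V;\mu)={}&Pr\int_\Omega\big(\mu_g\,\partial_x\mathbf u\cdot\partial_x\mathbf v+\tfrac1{\mu_g}\partial_y\mathbf u\cdot\partial_y\mathbf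 v\big)+b(\mathbf v,p)-b(\mathbf u,r)-Pr\,\mu_{ph}\,\mu_g\int_\Omega\theta v_2\\&+\int_\Omega\big(\mu_g u_1\partial_x\mathbf u+u_2\partial_y\mathbf u\big)\cdot\mathbf v+\int_\Omega\nu_T(\Pi_h^*\mathbf u)\big(\mu_g\,\partial_x\Pi_h^*\mathbf u\cdot\partial_x\Pi_h^*\mathbf v+\tfrac1{\mu_g}\partial_y\Pi_h^*\mathbf u\cdot\partial_y\Pi_h^*\mathbf v\big)\\&+\int_\Omega\big(\mu_g\,\partial_x\theta\,\partial_x\eta+\tfrac1{\mu_g}\partial_y\theta\,\partial_y\eta\big)+\int_\Omega\big(\mu_gu_1\partial_x\theta+u_2\partial_y\theta\big)\eta\\&+\tfrac1{Pr}\int_\Omega\nu_{T,n}(\Pi_h^*\mathbf u)\big(\mu_g\,\partial_x\Pi_h^*\theta\,\partial_x\Pi_h^*\eta+\tfrac1{\mu_g}\partial_y\Pi_h^*\theta\,\partial_y\Pi_h^*\eta\big),\end{aligned}$$ with $b(\mathbf v,p)=-\int_\Omega p\,(\mu_g\partial_xv_1+\partial_yv_2)$, and let $F(V;\mu)=\langle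 \mathbf f(\mu),\mathbf v\rangle+\langle Q(\mu),\eta\rangle$ with linear functionals $\mathbf f(\mu)$ on $Y_h$ and $Q(\mu)$ on $\Theta_h$. An *FE solution* for $\mu$ is a $U_h\in X_h$ with $A(U_h,V;\mu)=F(V;\mu)$ for all $V\in X_h$. Given FE solutions $U^k=(\mathbf u^k,\theta^k,p^k)$ for parameters $\mu^1,\dots,\mu^N$, let $X_N=Y_N\times\Theta_N\times M_N$, where $\Theta_N=\mathrm{span}\{\theta^k\}$, $M_N=\mathrm{span}\{p^k\}$, $Y_N=\mathrm{span}\{\mathbf u^k,\,T^\mu_pp^k\}$, and $T_p^\mu r\in Y_h$ is given by $\int_\Omega\nabla T_p^\mu r:\nabla\mathbf v=b(\mathbf v,r)$ for all $\mathbf v\in Y_h$. Let $U_N\in X_N$ be a *reduced-basis solution* for $\mu$: $A(U_N,V;\mu)=F(V;\mu)$ for all $V\in X_N$. Let $\partial_1A(U,V;\mu)(Z)$ be the Gateaux derivative of $A(\cdot,V;\mu)$ at $U\in X_h$ in the direction $Z\in X_h$, and put (all vectors ranging over $X_h\setminus\{0\}$) $$\beta_N=\inf_{Z}\sup_{V}\frac{\partial_1A(U_N,V;\mu)(Z)}{\|Z\|_X\|V\|_X},\quad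 \gamma_N=\sup_{Z}\sup_{V}\frac{\partial_1A(U_N,V;\mu)(Z)}{\|Z\|_X\|V\|_X},\quad \epsilon_N=\sup_V\frac{|A(U_N,V;\mu)-F(V;\mu)|}{\|V\|_X}.$$ **Theorem.** Fix $\mu$ with $\mu_g>0$, and suppose that $\beta_N>0$. The Gateaux derivative $\partial_1A(U,V;\mu)(Z)$ exists for all $U,V,Z\in X_h$, and there is a $\rho_n>0$ such that $$|\partial_1A(U_1,V;\mu)(Z)-\partial_1A(U_2,V;\mu)(Z)|\le\rho_n\|U_1-U_2\|_X\|Z\|_X\|V\|_X\qquad(Z,V\in X_h)$$ for all $U_1,U_2\in X_h$ in the closed $\|\cdot\|_X$-ball $B$ of centre $U_N$ and radius $\beta_N/\rho_n$. For every such $\rho_n$, with $$\tau_N=\frac{4\epsilon_N\rho_n}{\beta_N^2},\qquad \Delta_N=\frac{\beta_N}{2\rho_n}\Big(1-\sqrt{1-\tau_N}\Big),$$ the following hold. 1. If an FE solution $U_h$ for $\mu$ satisfies $\|U_h-U_N\|_X\le\beta_N/\rho_n$, it is the only FE solution for $\mu$ in $B$. 2. If $\tau_N\le1$, there is exactly one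 FE solution $U_h$ for $\mu$ with $\|U_h-U_N\|_X\le\Delta_N$, and it satisfies $$\Delta_N\le\Big(\frac{2\gamma_N}{\beta_N}+\tau_N\Big)\|U_h-U_N\|_X.$$ -/

import Mathlib

open MeasureTheory Set

noncomputable section

namespace NatConv

/-! ### The reference cavity and its uniform triangulations -/

/-- The open reference cavity `(0,1)²`. -/
def cavity : Set (ℝ × ℝ) := Ioo 0 1 ×ˢ Ioo 0 1

/-- The closed reference cavity `[0,1]²`. -/
def closedCavity : Set (ℝ × ℝ) := Icc 0 1 ×ˢ Icc 0 1

/-- The boundary of the reference cavity. -/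
def cavityBoundary : Set (ℝ × ℝ) := closedCavity \ cavity

/-- A uniform triangulation of the cavity: each side is cut into `Nh` equal parts, and every one of
the `Nh²` square cells is cut into two triangles along one of its two diagonals. -/
structure Mesh where
  Nh : ℕ
  Nh_pos : 0 < Nh
  /-- The diagonal used in cell `(i, j)`: `true` is the one of slope `1`, `false` that of slope `-1`. -/
  diag : Fin Nh → Fin Nh → Bool

/-- The half of the unit cell, in local coordinates `(s, t) ∈ [0,1]²`, on side `b` of the
diagonal `d`. -/
def halfCell (d b : Bool) (s t : ℝ) : Prop :=
  match d, b with
  | false, false => s + t ≤ 1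
  | false, true => 1 ≤ s + t
  | true, false => t ≤ s
  | true, true => s ≤ t

/-- The two closed triangles (`b = false, true`) of the cell `(i, j)`. -/
def Mesh.triangle (T : Mesh) (i j : Fin T.Nh) (b : Bool) : Set (ℝ × ℝ) :=
  {p | (T.Nh : ℝ) * p.1 - (i : ℕ) ∈ Icc (0 : ℝ) 1 ∧ (T.Nh : ℝ) * p.2 - (j : ℕ) ∈ Icc (0 : ℝ) 1 ∧
    halfCell (T.diag i j) b ((T.Nh : ℝ) * p.1 - (i : ℕ)) ((T.Nh : ℝ) * p.2 - (j : ℕ))}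

/-! ### Finite element spaces -/

/-- The Lagrange finite element space of degree `k`: functions continuous on the closed cavity whose
restriction to each closed triangle is a polynomial of total degree at most `k`. A function on the
closed cavity is represented by its extension by zero to the plane. -/
def feSpace (T : Mesh) (k : ℕ) : Submodule ℝ (ℝ × ℝ → ℝ) where
  carrier := {v | ContinuousOn v closedCavity ∧ (∀ p, p ∉ closedCavity → v p = 0) ∧
    ∀ i j b, ∃ P : MvPolynomial (Fin 2) ℝ, P.totalDegree ≤ k ∧
      ∀ p ∈ T.triangle i j b, v p = MvPolynomial.eval ![p.1, p.2] P}
  zero_mem' := ⟨continuousOn_const, fun _ _ => rfl, fun _ _ _ => ⟨0, by simp, by simp⟩⟩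
  add_mem' := by
    rintro v w ⟨hv, hv0, hvP⟩ ⟨hw, hw0, hwP⟩
    refine ⟨hv.add hw, fun p hp => by simp [hv0 p hp, hw0 p hp], fun i j b => ?_⟩
    obtain ⟨P, hP, hPe⟩ := hvP i j b
    obtain ⟨R, hR, hRe⟩ := hwP i j b
    exact ⟨P + R, (MvPolynomial.totalDegree_add P R).trans (max_le hP hR),
      fun p hp => by simp [hPe p hp, hRe p hp]⟩
  smul_mem' := by
    rintro c v ⟨hv, hv0, hvP⟩
    refine ⟨hv.const_smul c, fun p hp => by simp [hv0 p hp], fun i j b => ?_⟩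
    obtain ⟨P, hP, hPe⟩ := hvP i j b
    exact ⟨c • P, (MvPolynomial.totalDegree_smul_le c P).trans hP,
      fun p hp => by simp [hPe p hp, MvPolynomial.smul_eval]⟩

/-- Finite element functions vanishing on the part `Γ` of the boundary. For `Γ` the whole boundary
this is the intersection of the finite element space with `H¹₀`. -/
def feZero (T : Mesh) (k : ℕ) (Γ : Set (ℝ × ℝ)) : Submodule ℝ (ℝ × ℝ → ℝ) where
  carrier := {v | v ∈ feSpace T k ∧ ∀ p ∈ Γ, v p = 0}
  zero_mem' := ⟨(feSpace T k).zero_mem, fun _ _ => rfl⟩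
  add_mem' := fun {v w} hv hw =>
    ⟨(feSpace T k).add_mem hv.1 hw.1, fun p hp => by simp [hv.2 p hp, hw.2 p hp]⟩
  smul_mem' := fun c v hv => ⟨(feSpace T k).smul_mem c hv.1, fun p hp => by simp [hv.2 p hp]⟩

lemma feSpace_integrableOn {T : Mesh} {k : ℕ} {v : ℝ × ℝ → ℝ} (hv : v ∈ feSpace T k) :
    IntegrableOn v cavity :=
  (hv.1.integrableOn_compact (isCompact_Icc.prod isCompact_Icc)).mono_set
    (prod_mono Ioo_subset_Icc_self Ioo_subset_Icc_self)

/-- Finite element functions of mean value zero. -/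
def feMeanZero (T : Mesh) (k : ℕ) : Submodule ℝ (ℝ × ℝ → ℝ) where
  carrier := {v | v ∈ feSpace T k ∧ ∫ p in cavity, v p = 0}
  zero_mem' := ⟨(feSpace T k).zero_mem, by simp⟩
  add_mem' := fun {v w} hv hw => ⟨(feSpace T k).add_mem hv.1 hw.1, by
    have h := integral_add (feSpace_integrableOn hv.1) (feSpace_integrableOn hw.1)
    simp only [Pi.add_apply]
    rw [h, hv.2, hw.2, add_zero]⟩
  smul_mem' := fun c v hv => ⟨(feSpace T k).smul_mem c hv.1, by
    simp only [Pi.smul_apply, integral_smul, hv.2, smul_zero]⟩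

/-- A mesh, polynomial degrees `l`, `q`, `m` for velocity, temperature and pressure, and the
Dirichlet part `ΓD` of the boundary for the temperature. -/
structure Discretization extends Mesh where
  l : ℕ
  q : ℕ
  m : ℕ
  one_le_l : 1 ≤ l
  one_le_q : 1 ≤ q
  one_le_m : 1 ≤ m
  ΓD : Set (ℝ × ℝ)
  ΓD_subset : ΓD ⊆ cavityBoundary
  ΓD_nonempty : ΓD.Nonempty

/-- The velocity space. -/
abbrev Yh (D : Discretization) : Type :=
  feZero D.toMesh D.l cavityBoundary × feZero D.toMesh D.l cavityBoundary

/-- The temperature space. -/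
abbrev Θh (D : Discretization) : Type := feZero D.toMesh D.q D.ΓD

/-- The pressure space. -/
abbrev Mh (D : Discretization) : Type := feMeanZero D.toMesh D.m

/-- The product space of velocities, temperatures and pressures. -/
abbrev Xh (D : Discretization) : Type := Yh D × Θh D × Mh D

/-- The space of large-scale velocities (one degree less). -/
abbrev YhBar (D : Discretization) : Type :=
  feZero D.toMesh (D.l - 1) cavityBoundary × feZero D.toMesh (D.l - 1) cavityBoundary

/-- The space of large-scale temperatures (one degree less). -/
abbrev ΘhBar (D : Discretization) : Type := feZero D.toMesh (D.q - 1) D.ΓD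

/-- The data of the discrete model. A parameter is a pair `μ = (μ_ph, μ_g)`. -/
structure Model extends Discretization where
  /-- The Prandtl number. -/
  Pr : ℝ
  Pr_pos : 0 < Pr
  /-- The Smagorinsky constant. -/
  CS : ℝ
  /-- The profile of the mollifiers. -/
  φ : ℝ → ℝ
  φ_smooth : ContDiff ℝ (⊤ : ℕ∞) φ
  φ_support : tsupport φ ⊆ Metric.ball 0 1
  φ_nonneg : ∀ x, 0 ≤ φ x
  φ_even : ∀ x, φ (-x) = φ x
  φ_mass : 0 < ∫ x, |φ x|
  /-- The index of the mollifier. -/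
  n : ℕ
  one_le_n : 1 ≤ n
  /-- The interpolator of the velocities onto the large scales. -/
  interpY : Yh toDiscretization →ₗ[ℝ] YhBar toDiscretization
  /-- The interpolator of the temperatures onto the large scales. -/
  interpθ : Θh toDiscretization →ₗ[ℝ] ΘhBar toDiscretization
  /-- The body force, as a functional on the velocities, for each parameter. -/
  F : ℝ × ℝ → Yh toDiscretization →ₗ[ℝ] ℝ
  /-- The heat source, as a functional on the temperatures, for each parameter. -/
  Q : ℝ × ℝ → Θh toDiscretization →ₗ[ℝ] ℝ

/-! ### The forms on the reference cavity -/

/-- Scalar fields on the plane. -/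
abbrev Sc : Type := ℝ × ℝ → ℝ

/-- Vector fields on the plane. -/
abbrev Vec : Type := Sc × Sc

/-- Partial derivative in `x`. For finite element functions it exists off the mesh edges, a null set
in the cavity, and is there the weak derivative. -/
def dx (v : Sc) (p : ℝ × ℝ) : ℝ := deriv (fun s => v (s, p.2)) p.1

/-- Partial derivative in `y`. -/
def dy (v : Sc) (p : ℝ × ℝ) : ℝ := deriv (fun s => v (p.1, s)) p.2

/-- The velocity field of an element of the velocity space. -/
def Yh.field {D : Discretization} (u : Yh D) : Vec := (u.1, u.2)

/-- The diffusion form of the velocity, `a_{u,x} + a_{u,y}`. -/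
def au (Pr μg : ℝ) (u v : Vec) : ℝ :=
  Pr * μg * (∫ p in cavity, (dx u.1 p * dx v.1 p + dx u.2 p * dx v.2 p)) +
    Pr / μg * ∫ p in cavity, (dy u.1 p * dy v.1 p + dy u.2 p * dy v.2 p)

/-- The diffusion form of the temperature, `a_{θ,x} + a_{θ,y}`. -/
def aθ (μg : ℝ) (θ η : Sc) : ℝ :=
  μg * (∫ p in cavity, dx θ p * dx η p) + 1 / μg * ∫ p in cavity, dy θ p * dy η p

/-- The velocity-pressure form, `b_x + b_y`. -/
def b (μg : ℝ) (u : Vec) (r : Sc) : ℝ :=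
  -μg * (∫ p in cavity, r p * dx u.1 p) - ∫ p in cavity, r p * dy u.2 p

/-- The buoyancy form. -/
def buoy (Pr μph μg : ℝ) (θ : Sc) (v : Vec) : ℝ :=
  -(Pr * μph * μg) * ∫ p in cavity, θ p * v.2 p

/-- The convection form of the velocity, `c_{u,x} + c_{u,y}`. -/
def cu (μg : ℝ) (w u v : Vec) : ℝ :=
  μg * (∫ p in cavity, (w.1 p * dx u.1 p * v.1 p + w.1 p * dx u.2 p * v.2 p)) +
    ∫ p in cavity, (w.2 p * dy u.1 p * v.1 p + w.2 p * dy u.2 p * v.2 p)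

/-- The convection form of the temperature, `c_{θ,x} + c_{θ,y}`. -/
def cθ (μg : ℝ) (u : Vec) (θ η : Sc) : ℝ :=
  μg * (∫ p in cavity, u.1 p * dx θ p * η p) + ∫ p in cavity, u.2 p * dy θ p * η p

/-- The modulus of the velocity gradient in the original domain, pulled back to the reference
cavity. -/
def gradMod (μg : ℝ) (w : Vec) (p : ℝ × ℝ) : ℝ :=
  √((dx w.1 p) ^ 2 + 1 / μg ^ 2 * (dy w.1 p) ^ 2 + (dx w.2 p) ^ 2 + 1 / μg ^ 2 * (dy w.2 p) ^ 2)

namespace Model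

variable (P : Model)

/-- The small-scale part `Id - Π_h` of a velocity. -/
def smallY (u : Yh P.toDiscretization) : Vec :=
  ((u.1 : Sc) - ((P.interpY u).1 : Sc), (u.2 : Sc) - ((P.interpY u).2 : Sc))

/-- The small-scale part `Id - Π_h` of a temperature. -/
def smallθ (θ : Θh P.toDiscretization) : Sc := (θ : Sc) - (P.interpθ θ : Sc)

/-- The mollifier `φ_n`, of mass one. -/
def moll (x : ℝ) : ℝ := P.n / (∫ y, |P.φ y|) * P.φ (P.n * x)

/-- The mollified modulus `φ_n * |·|` on the real line. -/
def mollAbs : ℝ → ℝ := convolution P.moll (fun s => |s|) (ContinuousLinearMap.mul ℝ ℝ) volume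

/-- The eddy viscosity `ν_T`. -/
def νT (μg : ℝ) (w : Vec) (p : ℝ × ℝ) : ℝ :=
  P.CS ^ 2 * ((μg ^ 2 + 1) / (P.Nh : ℝ) ^ 2) * gradMod μg w p

/-- The mollified eddy viscosity `ν_{T,n}`. -/
def νTn (μg : ℝ) (w : Vec) (p : ℝ × ℝ) : ℝ :=
  P.CS ^ 2 * ((μg ^ 2 + 1) / (P.Nh : ℝ) ^ 2) * P.mollAbs (gradMod μg w p)

/-- The eddy viscosity term, `a'_{Su,x} + a'_{Su,y}`. -/
def aSu (μg : ℝ) (w u v : Yh P.toDiscretization) : ℝ :=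
  μg * (∫ p in cavity, P.νT μg (P.smallY w) p *
      (dx (P.smallY u).1 p * dx (P.smallY v).1 p + dx (P.smallY u).2 p * dx (P.smallY v).2 p)) +
    1 / μg * ∫ p in cavity, P.νT μg (P.smallY w) p *
      (dy (P.smallY u).1 p * dy (P.smallY v).1 p + dy (P.smallY u).2 p * dy (P.smallY v).2 p)

/-- The eddy diffusivity term, `a'_{Sθ,nx} + a'_{Sθ,ny}`. -/
def aSθ (μg : ℝ) (w : Yh P.toDiscretization) (θ η : Θh P.toDiscretization) : ℝ :=
  μg / P.Pr * (∫ p in cavity, P.νTn μg (P.smallY w) p *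
      (dx (P.smallθ θ) p * dx (P.smallθ η) p)) +
    1 / (P.Pr * μg) * ∫ p in cavity, P.νTn μg (P.smallY w) p *
      (dy (P.smallθ θ) p * dy (P.smallθ η) p)

/-- The operator `A(U, V; μ)` of the problem in compact form, with `U = (u, θ, p)`. -/
def A (μ : ℝ × ℝ) (U V : Xh P.toDiscretization) : ℝ :=
  au P.Pr μ.2 U.1.field V.1.field + b μ.2 V.1.field U.2.2 + P.aSu μ.2 U.1 U.1 V.1 +
    cu μ.2 U.1.field U.1.field V.1.field + buoy P.Pr μ.1 μ.2 U.2.1 V.1.field -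
    b μ.2 U.1.field V.2.2 +
    aθ μ.2 U.2.1 V.2.1 + cθ μ.2 U.1.field U.2.1 V.2.1 + P.aSθ μ.2 U.1 U.2.1 V.2.1

/-- The right-hand side `F(V; μ)` of the problem in compact form. -/
def rhs (μ : ℝ × ℝ) (V : Xh P.toDiscretization) : ℝ := P.F μ V.1 + P.Q μ V.2.1

/-- `U` solves the finite element problem for the parameter `μ`. -/
def IsFESolution (μ : ℝ × ℝ) (U : Xh P.toDiscretization) : Prop :=
  ∀ V, P.A μ U V = P.rhs μ V

/-- The Gateaux derivative `∂₁A(U, V; μ)(Z)` of `A` in its first variable at `U`, in the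
direction `Z`. -/
def dA (μ : ℝ × ℝ) (U V Z : Xh P.toDiscretization) : ℝ := lineDeriv ℝ (fun W => P.A μ W V) U Z

/-- The norm of the product space:
`‖U‖² = ‖∇u‖² + ‖∇θ‖² + ‖p‖²`, with norms in `L²` of the reference cavity. -/
def normX (U : Xh P.toDiscretization) : ℝ :=
  √((∫ p in cavity, ((dx U.1.1 p) ^ 2 + (dy U.1.1 p) ^ 2 + (dx U.1.2 p) ^ 2 + (dy U.1.2 p) ^ 2)) +
    (∫ p in cavity, ((dx U.2.1 p) ^ 2 + (dy U.2.1 p) ^ 2)) +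
    ∫ p in cavity, ((U.2.2 : Sc) p) ^ 2)

/-! ### The reduced basis problem -/

/-- `w` is the inner pressure supremizer `T_p^μ r` of the pressure `r`. -/
def IsSupremizer (μ : ℝ × ℝ) (r : Mh P.toDiscretization) (w : Yh P.toDiscretization) : Prop :=
  ∀ v : Yh P.toDiscretization,
    (∫ p in cavity, (dx w.1 p * dx v.1 p + dy w.1 p * dy v.1 p +
      dx w.2 p * dx v.2 p + dy w.2 p * dy v.2 p)) = b μ.2 v.field r

variable {N : ℕ}

/-- The reduced velocity space: the span of the velocity snapshots and of the supremizers of the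
pressure snapshots. -/
def YN (μ : ℝ × ℝ) (S : Fin N → Xh P.toDiscretization) : Submodule ℝ (Yh P.toDiscretization) :=
  Submodule.span ℝ (range (fun k => (S k).1) ∪ {w | ∃ k, P.IsSupremizer μ (S k).2.2 w})

/-- The reduced temperature space. -/
def ΘN (S : Fin N → Xh P.toDiscretization) : Submodule ℝ (Θh P.toDiscretization) :=
  Submodule.span ℝ (range fun k => (S k).2.1)

/-- The reduced pressure space. -/
def MN (S : Fin N → Xh P.toDiscretization) : Submodule ℝ (Mh P.toDiscretization) :=
  Submodule.span ℝ (range fun k => (S k).2.2)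

/-- The reduced product space. -/
def XN (μ : ℝ × ℝ) (S : Fin N → Xh P.toDiscretization) : Submodule ℝ (Xh P.toDiscretization) :=
  (P.YN μ S).prod ((P.ΘN S).prod (P.MN S))

/-- `U` solves, for the parameter `μ`, the reduced basis problem built on the snapshots `S`. -/
def IsRBSolution (μ : ℝ × ℝ) (S : Fin N → Xh P.toDiscretization) (U : Xh P.toDiscretization) :
    Prop :=
  U ∈ P.XN μ S ∧ ∀ V ∈ P.XN μ S, P.A μ U V = P.rhs μ V

/-! ### The constants of the error estimator -/

/-- The inf-sup constant `β_N` of the derivative at `UN`. -/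
def βN (μ : ℝ × ℝ) (UN : Xh P.toDiscretization) : ℝ :=
  ⨅ Z : {Z : Xh P.toDiscretization // Z ≠ 0}, ⨆ V : {V : Xh P.toDiscretization // V ≠ 0},
    P.dA μ UN V Z / (P.normX Z * P.normX V)

/-- The continuity constant `γ_N` of the derivative at `UN`. -/
def γN (μ : ℝ × ℝ) (UN : Xh P.toDiscretization) : ℝ :=
  ⨆ Z : {Z : Xh P.toDiscretization // Z ≠ 0}, ⨆ V : {V : Xh P.toDiscretization // V ≠ 0},
    P.dA μ UN V Z / (P.normX Z * P.normX V)

/-- The dual norm `ε_N` of the residual at `UN`. -/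
def εN (μ : ℝ × ℝ) (UN : Xh P.toDiscretization) : ℝ :=
  ⨆ V : {V : Xh P.toDiscretization // V ≠ 0}, |P.A μ UN V - P.rhs μ V| / P.normX V

/-- `ρ` is an admissible value of `ρ_n`: a positive Lipschitz constant of `∂₁A` on the closed
ball of centre `UN` and radius `β_N / ρ`. -/
def IsLipschitzConstant (μ : ℝ × ℝ) (UN : Xh P.toDiscretization) (ρ : ℝ) : Prop :=
  0 < ρ ∧ ∀ U₁ U₂ : Xh P.toDiscretization,
    P.normX (U₁ - UN) ≤ P.βN μ UN / ρ → P.normX (U₂ - UN) ≤ P.βN μ UN / ρ →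
    ∀ Z V : Xh P.toDiscretization,
      |P.dA μ U₁ V Z - P.dA μ U₂ V Z| ≤ ρ * P.normX (U₁ - U₂) * P.normX Z * P.normX V

/-- The quantity `τ_N = 4 ε_N ρ_n / β_N²`. -/
def τN (μ : ℝ × ℝ) (UN : Xh P.toDiscretization) (ρ : ℝ) : ℝ :=
  4 * P.εN μ UN * ρ / P.βN μ UN ^ 2

/-- The a posteriori error estimator `Δ_N`. -/
def ΔN (μ : ℝ × ℝ) (UN : Xh P.toDiscretization) (ρ : ℝ) : ℝ :=
  P.βN μ UN / (2 * ρ) * (1 - √(1 - P.τN μ UN ρ))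

end Model

end NatConv

end

/-!
Write the discrete problem as `H U = 0`, where `H U = A(U, ·; μ) - F(·; μ)` maps the space `X_h`
to its dual. The space is finite dimensional, and `‖·‖_X` is an inner product norm on it. The
theorem is the Newton-Kantorovich argument of Brezzi, Rappaz and Raviart for `H` at `U_N`, and rests
on two facts.

* *Regularity.* `H` is of class `C^{1,1}_loc` (`XE.locC11_op`), so that its Gateaux derivative is
  its Fréchet derivative and Lipschitz constants `ρ` exist. Off the edges of the mesh the gradients of
  finite element functions are bounded and continuous, so every term of `A` is an integral of
  products of bounded continuous functions on the open, full-measure set `Mesh.offEdges`, and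
  depends on `U` through continuous multilinear maps and superposition operators. Superposition with a
  function whose derivative is Lipschitz on balls is `C^{1,1}_loc` in the sup norm
  (`LipDerivOnBalls.locC11_superpose`). The eddy viscosity term uses `ξ ↦ ‖ξ‖ ξ`, which has this
  property although the modulus itself is not differentiable at `0`. The modulus alone stands in
  the eddy diffusivity, where it is mollified: `φ_n * |·|` is smooth and even, so its derivative
  vanishes at `0` and its composition with the norm has this property too.

* *Inf-sup stability.* `β_N > 0` says `β_N ‖Z‖ ≤ ‖DH(U_N) Z‖` in the dual norm, and in finite
  dimension this makes `DH(U_N)` invertible.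

For existence, the simplified Newton map `U ↦ U - DH(U_N)⁻¹ (H U)` is a contraction of the closed
ball of radius `Δ_N`, because `β_N Δ_N = ε_N + ρ Δ_N²` and `2 ρ Δ_N ≤ β_N`
(`exists_zero_of_newton`). For uniqueness in the closed ball of radius `β_N / ρ`, suppose that two
solutions differ by `Z ≠ 0`. The mean value theorem, with a test function at which `DH(U_N) Z`
attains its norm, gives a point `U_c` strictly between them with `β_N ≤ ρ ‖U_c - U_N‖`; but the norm
is strictly convex, so `U_c` lies in the open ball (`eq_of_apply_eq_of_norm_sub_le`). The
effectivity bound combines `Δ_N ≤ 2 ε_N / β_N` with an estimate of the residual `ε_N` by the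
error, obtained by linearizing `H` at `U_N` (`exists_zero_and_effectivity`).
-/

noncomputable section

namespace NatConv

open scoped Topology NNReal BoundedContinuousFunction

/-! ### Functions with locally Lipschitz derivative -/

section LocC11

variable {E F G : Type*} [NormedAddCommGroup E] [NormedSpace ℝ E] [NormedAddCommGroup F]
  [NormedSpace ℝ F] [NormedAddCommGroup G] [NormedSpace ℝ G]

/-- Functions of class `C^{1,1}_loc`: differentiable with a locally Lipschitz derivative. -/
def LocC11 (f : E → F) : Prop := Differentiable ℝ f ∧ LocallyLipschitz (fderiv ℝ f)

lemma _root_.ContDiff.locC11 {f : E → F} (hf : ContDiff ℝ 2 f) : LocC11 f :=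
  ⟨hf.differentiable (by norm_num),
    (hf.fderiv_right (m := 1) (by norm_num)).locallyLipschitz⟩

lemma _root_.ContinuousLinearMap.locC11 (L : E →L[ℝ] F) : LocC11 (fun x => L x) :=
  L.contDiff.locC11

lemma LocC11.locallyLipschitz {f : E → F} (hf : LocC11 f) : LocallyLipschitz f :=
  (contDiff_one_iff_fderiv.2 ⟨hf.1, hf.2.continuous⟩).locallyLipschitz

lemma _root_.LocallyLipschitz.clm_comp {X : Type*} [PseudoEMetricSpace X] {a : X → F →L[ℝ] G}
    {b : X → E →L[ℝ] F} (ha : LocallyLipschitz a) (hb : LocallyLipschitz b) :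
    LocallyLipschitz (fun x => (a x).comp (b x)) := by
  have hc : ContDiff ℝ 1 (fun p : (F →L[ℝ] G) × (E →L[ℝ] F) => p.1.comp p.2) :=
    contDiff_fst.clm_comp contDiff_snd
  have h := hc.locallyLipschitz.comp (ha.prodMk hb)
  exact h

lemma _root_.LocallyLipschitz.clm_prod {X : Type*} [PseudoEMetricSpace X] {a : X → E →L[ℝ] F}
    {b : X → E →L[ℝ] G} (ha : LocallyLipschitz a) (hb : LocallyLipschitz b) :
    LocallyLipschitz (fun x => (a x).prod (b x)) := by
  have hc : ContDiff ℝ 1 (fun p : (E →L[ℝ] F) × (E →L[ℝ] G) => p.1.prod p.2) :=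
    (ContinuousLinearMap.prodₗᵢ (𝕜 := ℝ) (E := E) (F := F) (G := G) ℝ).contDiff
  have h := hc.locallyLipschitz.comp (ha.prodMk hb)
  exact h

lemma LocC11.comp {g : F → G} {f : E → F} (hg : LocC11 g) (hf : LocC11 f) :
    LocC11 (fun x => g (f x)) := by
  have h : fderiv ℝ (fun x => g (f x)) = fun x => (fderiv ℝ g (f x)).comp (fderiv ℝ f x) :=
    funext fun x => fderiv_comp x (hg.1 _) (hf.1 _)
  have h1 := hg.2.comp hf.locallyLipschitz
  have h2 : LocallyLipschitz (fderiv ℝ (fun x => g (f x))) := h ▸ h1.clm_comp hf.2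
  exact ⟨hg.1.comp hf.1, h2⟩

lemma LocC11.prodMk {f : E → F} {g : E → G} (hf : LocC11 f) (hg : LocC11 g) :
    LocC11 (fun x => (f x, g x)) := by
  have h : fderiv ℝ (fun x => (f x, g x)) = fun x => (fderiv ℝ f x).prod (fderiv ℝ g x) :=
    funext fun x => (hf.1 x).fderiv_prodMk (hg.1 x)
  have h2 : LocallyLipschitz (fderiv ℝ (fun x => (f x, g x))) := h ▸ hf.2.clm_prod hg.2
  exact ⟨hf.1.prodMk hg.1, h2⟩

lemma LocC11.add {f g : E → F} (hf : LocC11 f) (hg : LocC11 g) : LocC11 (fun x => f x + g x) :=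
  LocC11.comp (g := fun p : F × F => p.1 + p.2)
    (ContDiff.locC11 (contDiff_fst.add contDiff_snd)) (hf.prodMk hg)

lemma LocC11.mul {A : Type*} [NormedRing A] [NormedAlgebra ℝ A] {f g : E → A}
    (hf : LocC11 f) (hg : LocC11 g) : LocC11 (fun x => f x * g x) :=
  LocC11.comp (g := fun p : A × A => p.1 * p.2)
    (ContDiff.locC11 (contDiff_fst.mul contDiff_snd)) (hf.prodMk hg)

lemma LocC11.clm {f : E → F} (hf : LocC11 f) (L : F →L[ℝ] G) : LocC11 (fun x => L (f x)) :=
  L.locC11.comp hf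

lemma locC11_const (c : F) : LocC11 (fun _ : E => c) := contDiff_const.locC11

lemma LocC11.sum {ι : Type*} {f : ι → E → F} (s : Finset ι) (hf : ∀ i, LocC11 (f i)) :
    LocC11 (fun x => ∑ i ∈ s, f i x) := by
  classical
  induction s using Finset.induction_on with
  | empty => simpa using locC11_const (0 : F)
  | insert a s ha ih => simpa [Finset.sum_insert ha] using (hf a).add ih

end LocC11

/-! ### The simplified Newton method -/

section Newton

variable {E : Type*} [NormedAddCommGroup E] [InnerProductSpace ℝ E]

/-- Along segments in a ball around `U₀` the linearization error is controlled by the Lipschitz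
constant of the derivative. -/
lemma norm_sub_sub_fderiv_le {H : E → E →L[ℝ] ℝ} (hd : Differentiable ℝ H) {U₀ : E}
    {ρ R : ℝ} (hρ : 0 ≤ ρ)
    (hLip : ∀ U, ‖U - U₀‖ ≤ R → ‖fderiv ℝ H U - fderiv ℝ H U₀‖ ≤ ρ * ‖U - U₀‖)
    {U W : E} {r : ℝ} (hrR : r ≤ R) (hU : ‖U - U₀‖ ≤ r) (hW : ‖W - U₀‖ ≤ r) :
    ‖H U - H W - fderiv ℝ H U₀ (U - W)‖ ≤ ρ * r * ‖U - W‖ := by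
  refine (convex_closedBall U₀ r).norm_image_sub_le_of_norm_fderiv_le' (𝕜 := ℝ)
    (fun x _ => hd x) (fun x hx => ?_) (mem_closedBall_iff_norm.2 hW) (mem_closedBall_iff_norm.2 hU)
  have hx' := mem_closedBall_iff_norm.1 hx
  exact (hLip x (hx'.trans hrR)).trans (by gcongr)

variable [FiniteDimensional ℝ E]

/-- A vector at which a functional attains its norm. -/
lemma exists_apply_eq_norm_mul_norm (ℓ : E →L[ℝ] ℝ) :
    ∃ V : E, ℓ V = ‖ℓ‖ * ‖V‖ ∧ ‖V‖ = ‖ℓ‖ := by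
  refine ⟨(InnerProductSpace.toDual ℝ E).symm ℓ, ?_, by simp⟩
  rw [← InnerProductSpace.toDual_symm_apply (𝕜 := ℝ), real_inner_self_eq_norm_sq]
  simp [sq]

/-- Two zeros in the closed ball of radius `β / ρ` agree. Testing the mean value identity with a
vector norming `fderiv ℝ H U₀ (U - W)` puts the derivative at a point strictly between `U` and `W`,
hence, the norm being strictly convex, in the open ball. -/
lemma eq_of_apply_eq_of_norm_sub_le {H : E → E →L[ℝ] ℝ} (hd : Differentiable ℝ H) {U₀ : E}
    {β ρ : ℝ} (hρ : 0 < ρ)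
    (hβ : ∀ Z, β * ‖Z‖ ≤ ‖fderiv ℝ H U₀ Z‖)
    (hLip : ∀ U, ‖U - U₀‖ ≤ β / ρ → ‖fderiv ℝ H U - fderiv ℝ H U₀‖ ≤ ρ * ‖U - U₀‖)
    {U W : E} (hU : ‖U - U₀‖ ≤ β / ρ) (hW : ‖W - U₀‖ ≤ β / ρ) (h : H U = H W) : U = W := by
  by_contra hne
  have hZ : 0 < ‖U - W‖ := norm_pos_iff.2 (sub_ne_zero.2 hne)
  have hβ0 : 0 ≤ β := by
    have := (norm_nonneg _).trans hU
    by_contra hneg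
    exact absurd this (not_le.2 (div_neg_of_neg_of_pos (not_le.1 hneg) hρ))
  have hr0 : 0 < β / ρ := by
    rcases (norm_nonneg _).trans hU |>.eq_or_lt with h0 | h0
    · rw [← h0] at hU hW
      exact absurd ((sub_eq_zero.1 (norm_le_zero_iff.1 hU)).trans
        (sub_eq_zero.1 (norm_le_zero_iff.1 hW)).symm) hne
    · exact h0
  have hβp : 0 < β := by
    have := mul_pos hr0 hρ
    rwa [div_mul_cancel₀ _ hρ.ne'] at this
  obtain ⟨V, hV, hVn⟩ := exists_apply_eq_norm_mul_norm (fderiv ℝ H U₀ (U - W))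
  have hVp : 0 < ‖V‖ := hVn ▸ (mul_pos hβp hZ).trans_le (hβ _)
  -- the mean value theorem on the segment from `W` to `U`
  have hder : ∀ t : ℝ, HasDerivAt (fun t : ℝ => H (W + t • (U - W)) V)
      (fderiv ℝ H (W + t • (U - W)) (U - W) V) t := by
    intro t
    have h1 : HasDerivAt (fun t : ℝ => W + t • (U - W)) (U - W) t := by
      simpa using ((hasDerivAt_id t).smul_const (U - W)).const_add W
    have h2 := (hd (W + t • (U - W))).hasFDerivAt.comp_hasDerivAt t h1
    exact (ContinuousLinearMap.apply ℝ ℝ V).hasFDerivAt.comp_hasDerivAt t h2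
  obtain ⟨c, hc, hce⟩ := exists_hasDerivAt_eq_slope _ _ zero_lt_one
    (fun t _ => (hder t).continuousAt.continuousWithinAt) (fun t _ => hder t)
  have hc0 : fderiv ℝ H (W + c • (U - W)) (U - W) V = 0 := by
    rw [hce]; simp [h]
  have hball : ‖(W + c • (U - W)) - U₀‖ < β / ρ := by
    have := combo_mem_ball_of_ne (x := W) (y := U) (z := U₀) (r := β / ρ) (a := 1 - c) (b := c)
      (mem_closedBall_iff_norm.2 hW) (mem_closedBall_iff_norm.2 hU) (Ne.symm hne)
      (by linarith [hc.2]) hc.1 (by ring)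
    rw [mem_ball_iff_norm] at this
    rwa [show W + c • (U - W) = (1 - c) • W + c • U by module]
  have h1 : β * ‖U - W‖ * ‖V‖ ≤ (fderiv ℝ H U₀ (U - W)) V := by
    rw [hV]; gcongr; exact hβ _
  have h2 : (fderiv ℝ H U₀ (U - W)) V ≤
      ρ * ‖(W + c • (U - W)) - U₀‖ * ‖U - W‖ * ‖V‖ := by
    calc (fderiv ℝ H U₀ (U - W)) V
        = -((fderiv ℝ H (W + c • (U - W)) - fderiv ℝ H U₀) (U - W) V) := by
          rw [sub_apply, sub_apply, hc0]; ring
      _ ≤ ‖(fderiv ℝ H (W + c • (U - W)) - fderiv ℝ H U₀) (U - W) V‖ := neg_le_abs _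
      _ ≤ ‖fderiv ℝ H (W + c • (U - W)) - fderiv ℝ H U₀‖ * ‖U - W‖ * ‖V‖ :=
        ContinuousLinearMap.le_opNorm₂ _ _ _
      _ ≤ _ := by gcongr; exact hLip _ hball.le
  have h3 : ρ * ‖(W + c • (U - W)) - U₀‖ < β := by
    rw [mul_comm]; exact (lt_div_iff₀ hρ).1 hball
  have := mul_lt_mul_of_pos_right h3 (mul_pos hZ hVp)
  linarith

/-- The simplified Newton map at `U₀` maps the closed ball of radius `Δ`, where
`β Δ = ε + ρ Δ²`, to itself and is a contraction there, so `H` has a zero in that ball. -/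
lemma exists_zero_of_newton {H : E → E →L[ℝ] ℝ} (hd : Differentiable ℝ H) {U₀ : E}
    {β ρ ε Δ : ℝ} (hβ0 : 0 < β) (hρ : 0 < ρ)
    (hβ : ∀ Z, β * ‖Z‖ ≤ ‖fderiv ℝ H U₀ Z‖)
    (hLip : ∀ U, ‖U - U₀‖ ≤ β / ρ → ‖fderiv ℝ H U - fderiv ℝ H U₀‖ ≤ ρ * ‖U - U₀‖)
    (hε : ‖H U₀‖ ≤ ε) (hΔ0 : 0 ≤ Δ) (hΔ : ε + ρ * Δ ^ 2 = β * Δ) (hΔ2 : 2 * ρ * Δ ≤ β) :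
    ∃ U, ‖U - U₀‖ ≤ Δ ∧ H U = 0 := by
  have hΔr : Δ ≤ β / ρ := by rw [le_div_iff₀ hρ]; nlinarith
  let D : E →ₗ[ℝ] (E →L[ℝ] ℝ) := (fderiv ℝ H U₀).toLinearMap
  have hinj : Function.Injective D := by
    rw [injective_iff_map_eq_zero]
    intro Z hZ
    have h1 := hβ Z
    rw [show fderiv ℝ H U₀ Z = 0 from hZ, norm_zero] at h1
    exact norm_le_zero_iff.1 (by nlinarith [norm_nonneg Z])
  have hfin : Module.finrank ℝ E = Module.finrank ℝ (E →L[ℝ] ℝ) :=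
    (LinearMap.toContinuousLinearMap (𝕜 := ℝ) (E := E) (F' := ℝ)).finrank_eq ▸
      (Subspace.dual_finrank_eq (K := ℝ) (V := E)).symm
  let e : E ≃ₗ[ℝ] (E →L[ℝ] ℝ) := LinearEquiv.ofInjectiveOfFinrankEq D hinj hfin
  have he : ∀ Z, e Z = fderiv ℝ H U₀ Z := fun Z => rfl
  let T : E → E := fun U => U - e.symm (H U)
  have hT : ∀ U W, ‖U - U₀‖ ≤ Δ → ‖W - U₀‖ ≤ Δ → β * ‖T U - T W‖ ≤ ρ * Δ * ‖U - W‖ := by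
    intro U W hU hW
    refine (hβ _).trans ?_
    have : fderiv ℝ H U₀ (T U - T W) = -(H U - H W - fderiv ℝ H U₀ (U - W)) := by
      simp only [← he, T, map_sub, LinearEquiv.apply_symm_apply]
      abel
    rw [this, norm_neg]
    exact norm_sub_sub_fderiv_le hd hρ.le hLip hΔr hU hW
  have hmaps : MapsTo T (Metric.closedBall U₀ Δ) (Metric.closedBall U₀ Δ) := by
    intro U hU
    rw [mem_closedBall_iff_norm] at hU ⊢
    have h1 := hT U U₀ hU (by simpa using hΔ0)
    have h2 : β * ‖T U₀ - U₀‖ ≤ ε := by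
      refine (hβ _).trans ?_
      have : fderiv ℝ H U₀ (T U₀ - U₀) = -(H U₀) := by
        simp only [← he, T, map_sub, LinearEquiv.apply_symm_apply]
        abel
      rwa [this, norm_neg]
    have h3 : ‖T U - U₀‖ ≤ ‖T U - T U₀‖ + ‖T U₀ - U₀‖ := norm_sub_le_norm_sub_add_norm_sub _ _ _
    have h4 : ρ * Δ * ‖U - U₀‖ ≤ ρ * Δ * Δ := by gcongr
    have : β * ‖T U - U₀‖ ≤ β * Δ := by nlinarith
    exact le_of_mul_le_mul_left this hβ0
  have hcontr : ContractingWith (1 / 2) (hmaps.restrict T _ _) := by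
    refine ⟨by rw [← NNReal.coe_lt_coe]; norm_num, LipschitzWith.of_dist_le_mul fun U W => ?_⟩
    have h1 := hT U W (mem_closedBall_iff_norm.1 U.2) (mem_closedBall_iff_norm.1 W.2)
    rw [Subtype.dist_eq, Subtype.dist_eq, dist_eq_norm, dist_eq_norm]
    simp only [MapsTo.val_restrict_apply]
    have h2 : ρ * Δ * ‖(U : E) - W‖ ≤ β / 2 * ‖(U : E) - W‖ := by gcongr; linarith
    refine le_of_mul_le_mul_left (h1.trans (h2.trans (le_of_eq ?_))) hβ0
    push_cast
    ring
  obtain ⟨U, hU, hfix, -⟩ := hcontr.exists_fixedPoint' Metric.isClosed_closedBall.isComplete hmaps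
    (Metric.mem_closedBall_self hΔ0) (edist_ne_top _ _)
  refine ⟨U, mem_closedBall_iff_norm.1 hU, ?_⟩
  have : e.symm (H U) = 0 := by
    have : U - e.symm (H U) = U := hfix
    simpa using this
  simpa using this

end Newton

/-! ### Superposition operators -/

section Superposition

variable {α K K' : Type*} [TopologicalSpace α] [NormedAddCommGroup K] [NormedAddCommGroup K']

/-- The superposition (Nemytskii) operator `f ↦ h ∘ f` on bounded continuous functions with values
in a proper space. -/
def superpose [ProperSpace K] (h : K → K') (hc : Continuous h) (f : α →ᵇ K) : α →ᵇ K' where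
  toFun ω := h (f ω)
  continuous_toFun := hc.comp f.continuous
  map_bounded' := by
    have hb : Bornology.IsBounded (h '' Metric.closedBall 0 ‖f‖) :=
      ((isCompact_closedBall 0 ‖f‖).image hc).isBounded
    obtain ⟨C, hC⟩ := Metric.isBounded_iff.1 hb
    have hm : ∀ ω, f ω ∈ Metric.closedBall 0 ‖f‖ := fun ω =>
      mem_closedBall_zero_iff.2 (f.norm_coe_le_norm ω)
    exact ⟨C, fun x y => hC (mem_image_of_mem h (hm x)) (mem_image_of_mem h (hm y))⟩

@[simp]
lemma superpose_apply [ProperSpace K] (h : K → K') (hc : Continuous h) (f : α →ᵇ K) (ω : α) :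
    superpose h hc f ω = h (f ω) := rfl

variable [NormedSpace ℝ K] [NormedSpace ℝ K']

/-- Differentiable functions whose derivative is Lipschitz on every ball. -/
def LipDerivOnBalls (h : K → K') : Prop :=
  Differentiable ℝ h ∧ ∀ R : ℝ, ∃ C : ℝ, 0 ≤ C ∧ ∀ x y : K, ‖x‖ ≤ R → ‖y‖ ≤ R →
    ‖fderiv ℝ h x - fderiv ℝ h y‖ ≤ C * ‖x - y‖

lemma LipDerivOnBalls.continuous_fderiv {h : K → K'} (hh : LipDerivOnBalls h) :
    Continuous (fderiv ℝ h) := by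
  have : LocallyLipschitz (fderiv ℝ h) := by
    intro x
    obtain ⟨C, hC, hCl⟩ := hh.2 (‖x‖ + 1)
    refine ⟨C.toNNReal, Metric.ball x 1, Metric.ball_mem_nhds _ one_pos,
      LipschitzOnWith.of_dist_le_mul fun y hy z hz => ?_⟩
    rw [dist_eq_norm, dist_eq_norm, Real.coe_toNNReal _ hC]
    have hb : ∀ w ∈ Metric.ball x 1, ‖w‖ ≤ ‖x‖ + 1 := fun w hw =>
      (norm_le_norm_add_norm_sub' w x).trans (by rw [mem_ball_iff_norm] at hw; linarith)
    exact hCl y z (hb y hy) (hb z hz)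
  exact this.continuous

lemma norm_apply_apply_le (a : α →ᵇ (K →L[ℝ] K')) (k : α →ᵇ K) (ω : α) :
    ‖a ω (k ω)‖ ≤ ‖a‖ * ‖k‖ :=
  ((a ω).le_opNorm _).trans (mul_le_mul (a.norm_coe_le_norm ω)
    (k.norm_coe_le_norm ω) (norm_nonneg _) (norm_nonneg a))

/-- A bounded continuous field of operators, acting pointwise. -/
def pointwiseCLM (a : α →ᵇ (K →L[ℝ] K')) : (α →ᵇ K) →L[ℝ] (α →ᵇ K') :=
  LinearMap.mkContinuous
    { toFun := fun k => BoundedContinuousFunction.ofNormedAddCommGroup (fun ω => a ω (k ω))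
        (a.continuous.clm_apply k.continuous) (‖a‖ * ‖k‖) (norm_apply_apply_le a k)
      map_add' := fun k k' => by ext ω; simp
      map_smul' := fun c k => by ext ω; simp }
    ‖a‖ (fun k => BoundedContinuousFunction.norm_ofNormedAddCommGroup_le _ (by positivity)
      (norm_apply_apply_le a k))

lemma pointwiseCLM_apply (a : α →ᵇ (K →L[ℝ] K')) (k : α →ᵇ K) (ω : α) :
    pointwiseCLM a k ω = a ω (k ω) := rfl

lemma norm_pointwiseCLM_sub_le (a a' : α →ᵇ (K →L[ℝ] K')) :
    ‖pointwiseCLM a - pointwiseCLM a'‖ ≤ ‖a - a'‖ := by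
  have : pointwiseCLM a - pointwiseCLM a' = pointwiseCLM (a - a') := by
    ext k ω
    simp [pointwiseCLM_apply]
  rw [this]
  refine ContinuousLinearMap.opNorm_le_bound _ (norm_nonneg (a - a')) fun k => ?_
  exact BoundedContinuousFunction.norm_ofNormedAddCommGroup_le _ (by positivity)
    (norm_apply_apply_le _ k)

/-- Superposition operators inherit the `C^{1,1}` regularity of the function. -/
lemma LipDerivOnBalls.locC11_superpose [ProperSpace K] {h : K → K'} (hh : LipDerivOnBalls h) :
    LocC11 (superpose (α := α) h hh.1.continuous) := by
  have hder : ∀ f : α →ᵇ K, HasFDerivAt (superpose (α := α) h hh.1.continuous)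
      (pointwiseCLM (superpose (fderiv ℝ h) hh.continuous_fderiv f)) f := by
    intro f
    obtain ⟨C, hC, hCl⟩ := hh.2 (‖f‖ + 1)
    set D := pointwiseCLM (superpose (fderiv ℝ h) hh.continuous_fderiv f)
    have key : ∀ g ∈ Metric.ball f 1,
        ‖superpose (α := α) h hh.1.continuous g - superpose h hh.1.continuous f - D (g - f)‖ ≤
          C * ‖‖g - f‖ ^ 2‖ := by
      intro g hg
      rw [mem_ball_iff_norm] at hg
      rw [BoundedContinuousFunction.norm_le (by positivity)]
      intro ω
      have hfg : ‖g ω - f ω‖ ≤ ‖g - f‖ := (g - f).norm_coe_le_norm ω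
      have hconv := (convex_closedBall (f ω) ‖g - f‖).norm_image_sub_le_of_norm_fderiv_le'
        (𝕜 := ℝ) (f := h) (φ := fderiv ℝ h (f ω)) (C := C * ‖g - f‖) (x := f ω) (y := g ω)
        (fun x _ => hh.1 x)
        (fun x hx => by
          rw [mem_closedBall_iff_norm] at hx
          have h1 : ‖f ω‖ ≤ ‖f‖ + 1 := (f.norm_coe_le_norm ω).trans (by linarith)
          have h2 : ‖x‖ ≤ ‖f‖ + 1 := (norm_le_norm_add_norm_sub' x (f ω)).trans
            (add_le_add (f.norm_coe_le_norm ω) (hx.trans hg.le))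
          exact (hCl x (f ω) h2 h1).trans (by gcongr))
        (Metric.mem_closedBall_self (norm_nonneg _)) (mem_closedBall_iff_norm.2 hfg)
      calc ‖h (g ω) - h (f ω) - fderiv ℝ h (f ω) (g ω - f ω)‖
          ≤ C * ‖g - f‖ * ‖g ω - f ω‖ := hconv
        _ ≤ C * ‖g - f‖ * ‖g - f‖ := by gcongr
        _ = C * ‖‖g - f‖ ^ 2‖ := by rw [norm_pow, norm_norm]; ring
    have hO : (fun g => superpose (α := α) h hh.1.continuous g - superpose h hh.1.continuous f -
        D (g - f)) =O[𝓝 f] fun g => ‖g - f‖ ^ 2 :=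
      Asymptotics.IsBigO.of_bound C
        (Filter.eventually_of_mem (Metric.ball_mem_nhds f one_pos) key)
    have h0 := hO.hasFDerivAt (𝕜 := ℝ) one_lt_two
    have h1 : HasFDerivAt (fun g => superpose (α := α) h hh.1.continuous f + D (g - f)) D f :=
      (D.hasFDerivAt.comp f ((hasFDerivAt_id f).sub_const f)).const_add _
    have h2 := h0.add h1
    rw [zero_add] at h2
    refine h2.congr_of_eventuallyEq (Filter.Eventually.of_forall fun g => ?_)
    simp
  refine ⟨fun f => (hder f).differentiableAt, fun f => ?_⟩
  obtain ⟨C, hC, hCl⟩ := hh.2 (‖f‖ + 1)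
  refine ⟨C.toNNReal, Metric.ball f 1, Metric.ball_mem_nhds _ one_pos,
    LipschitzOnWith.of_dist_le_mul fun g hg g' hg' => ?_⟩
  rw [dist_eq_norm, dist_eq_norm, Real.coe_toNNReal _ hC, (hder g).fderiv, (hder g').fderiv]
  refine (norm_pointwiseCLM_sub_le _ _).trans ?_
  rw [BoundedContinuousFunction.norm_le (by positivity)]
  intro ω
  have hb : ∀ w ∈ Metric.ball f 1, ‖w ω‖ ≤ ‖f‖ + 1 := fun w hw =>
    (w.norm_coe_le_norm ω).trans ((norm_le_norm_add_norm_sub' w f).trans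
      (by rw [mem_ball_iff_norm] at hw; linarith))
  exact (hCl _ _ (hb g hg) (hb g' hg')).trans (by gcongr; exact (g - g').norm_coe_le_norm ω)

end Superposition

/-! ### Radial functions -/

section Radial

variable {K : Type*} [NormedAddCommGroup K] [InnerProductSpace ℝ K]

lemma norm_inv_norm_smul_le_one (ξ : K) : ‖‖ξ‖⁻¹ • ξ‖ ≤ 1 := by
  rw [norm_smul, norm_inv, norm_norm]
  exact inv_mul_le_one

/-- The normalization `ξ ↦ ‖ξ‖⁻¹ ξ` is Lipschitz away from `0`, with a constant that blows up like
the inverse of the norm. For `ξ = 0` or `η = 0` the convention `0⁻¹ = 0` keeps the bound true. -/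
lemma norm_mul_norm_unit_sub_unit_le (ξ η : K) :
    ‖η‖ * ‖‖ξ‖⁻¹ • ξ - ‖η‖⁻¹ • η‖ ≤ 2 * ‖ξ - η‖ := by
  rcases eq_or_ne η 0 with rfl | hη
  · simp
  have hη' : ‖η‖ ≠ 0 := norm_ne_zero_iff.2 hη
  have h1 : ‖η‖ • (‖ξ‖⁻¹ • ξ - ‖η‖⁻¹ • η) =
      (‖η‖ - ‖ξ‖) • (‖ξ‖⁻¹ • ξ) + (ξ - η) := by
    rcases eq_or_ne ξ 0 with rfl | hξ
    · simp [smul_smul, hη']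
    · have hξ' : ‖ξ‖ ≠ 0 := norm_ne_zero_iff.2 hξ
      rw [sub_smul ‖η‖ ‖ξ‖]
      simp only [smul_sub, smul_smul, mul_inv_cancel₀ hη', mul_inv_cancel₀ hξ', one_smul]
      abel
  calc ‖η‖ * ‖‖ξ‖⁻¹ • ξ - ‖η‖⁻¹ • η‖ = ‖‖η‖ • (‖ξ‖⁻¹ • ξ - ‖η‖⁻¹ • η)‖ := by
        rw [norm_smul, norm_norm]
    _ ≤ ‖‖η‖ - ‖ξ‖‖ * ‖‖ξ‖⁻¹ • ξ‖ + ‖ξ - η‖ := by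
        rw [h1, ← norm_smul]; exact norm_add_le _ _
    _ ≤ ‖ξ - η‖ * 1 + ‖ξ - η‖ := by
        refine add_le_add (mul_le_mul ?_ (norm_inv_norm_smul_le_one ξ) (norm_nonneg _)
          (norm_nonneg _)) le_rfl
        rw [norm_sub_rev ξ η]; exact abs_norm_sub_norm_le η ξ
    _ = _ := by ring

lemma hasFDerivAt_norm_of_ne_zero {ξ : K} (hξ : ξ ≠ 0) :
    HasFDerivAt (fun x : K => ‖x‖) (‖ξ‖⁻¹ • innerSL ℝ ξ) ξ := by
  have h0 : ‖ξ‖ ≠ 0 := norm_ne_zero_iff.2 hξ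
  have h := (hasStrictFDerivAt_norm_sq ξ).hasFDerivAt.sqrt (by positivity)
  simp only [Real.sqrt_sq (norm_nonneg _)] at h
  convert h using 1
  rw [← Nat.cast_smul_eq_nsmul ℝ, smul_smul]
  congr 1
  field_simp
  norm_num

/-- The map `ξ ↦ ‖ξ‖ ξ` is of class `C^{1,1}`. -/
lemma lipDerivOnBalls_norm_smul : LipDerivOnBalls (fun ξ : K => ‖ξ‖ • ξ) := by
  -- at `ξ = 0` the convention `0⁻¹ = 0` makes this formula give the derivative `0`
  have hder : ∀ ξ : K, HasFDerivAt (fun ξ : K => ‖ξ‖ • ξ)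
      ((innerSL ℝ ξ).smulRight (‖ξ‖⁻¹ • ξ) + ‖ξ‖ • ContinuousLinearMap.id ℝ K) ξ := by
    intro ξ
    rcases eq_or_ne ξ 0 with rfl | hξ
    · have h0 : (fun ξ : K => ‖ξ‖ • ξ) =O[𝓝 0] fun ξ => ‖ξ - 0‖ ^ 2 :=
        Asymptotics.IsBigO.of_bound 1 (Filter.Eventually.of_forall fun ξ => by
          simp [norm_smul, sq])
      convert h0.hasFDerivAt (𝕜 := ℝ) one_lt_two using 1
      ext; simp
    · have h := (hasFDerivAt_norm_of_ne_zero hξ).smul (hasFDerivAt_id ξ)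
      have he : (innerSL ℝ ξ).smulRight (‖ξ‖⁻¹ • ξ) + ‖ξ‖ • ContinuousLinearMap.id ℝ K =
          ‖ξ‖ • ContinuousLinearMap.id ℝ K + (‖ξ‖⁻¹ • innerSL ℝ ξ).smulRight (id ξ) := by
        ext ζ
        simp [smul_smul, mul_comm, add_comm]
      rw [he]
      exact h
  refine ⟨fun ξ => (hder ξ).differentiableAt, fun R => ⟨4, by norm_num, fun ξ η _ _ => ?_⟩⟩
  rw [(hder ξ).fderiv, (hder η).fderiv]
  have hsplit : (innerSL ℝ ξ).smulRight (‖ξ‖⁻¹ • ξ) + ‖ξ‖ • ContinuousLinearMap.id ℝ K -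
      ((innerSL ℝ η).smulRight (‖η‖⁻¹ • η) + ‖η‖ • ContinuousLinearMap.id ℝ K) =
      (innerSL ℝ (ξ - η)).smulRight (‖ξ‖⁻¹ • ξ) +
        (innerSL ℝ η).smulRight (‖ξ‖⁻¹ • ξ - ‖η‖⁻¹ • η) +
        (‖ξ‖ - ‖η‖) • ContinuousLinearMap.id ℝ K := by
    ext ζ
    simp only [add_apply, sub_apply, ContinuousLinearMap.smulRight_apply, smul_apply,
      ContinuousLinearMap.id_apply, innerSL_apply_apply, inner_sub_left, sub_smul, smul_sub]
    abel
  rw [hsplit]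
  calc _ ≤ ‖ξ - η‖ * 1 + ‖η‖ * ‖‖ξ‖⁻¹ • ξ - ‖η‖⁻¹ • η‖ + ‖ξ - η‖ * 1 := by
        refine (norm_add₃_le).trans ?_
        rw [ContinuousLinearMap.norm_smulRight_apply, ContinuousLinearMap.norm_smulRight_apply,
          innerSL_apply_norm, innerSL_apply_norm, norm_smul (‖ξ‖ - ‖η‖)]
        refine add_le_add (add_le_add ?_ le_rfl) ?_
        · exact mul_le_mul_of_nonneg_left (norm_inv_norm_smul_le_one ξ) (norm_nonneg _)
        · exact mul_le_mul (abs_norm_sub_norm_le ξ η) ContinuousLinearMap.norm_id_le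
            (norm_nonneg (ContinuousLinearMap.id ℝ K)) (norm_nonneg _)
    _ ≤ ‖ξ - η‖ * 1 + 2 * ‖ξ - η‖ + ‖ξ - η‖ * 1 :=
        add_le_add (add_le_add le_rfl (norm_mul_norm_unit_sub_unit_le ξ η)) le_rfl
    _ = 4 * ‖ξ - η‖ := by ring

/-- A radial function with a `C²` profile whose derivative vanishes at `0` is of class
`C^{1,1}_loc`. -/
lemma lipDerivOnBalls_comp_norm {g : ℝ → ℝ} (hg : ContDiff ℝ 2 g) (hg0 : deriv g 0 = 0) :
    LipDerivOnBalls (fun ξ : K => g ‖ξ‖) := by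
  have hgd : Differentiable ℝ g := hg.differentiable (by norm_num)
  have hg' : ContDiff ℝ 1 (deriv g) := by
    have : ContDiff ℝ (1 + 1) g := hg.of_le (by norm_num)
    exact (contDiff_succ_iff_deriv.1 this).2.2
  have hder : ∀ ξ : K, HasFDerivAt (fun ξ : K => g ‖ξ‖)
      (deriv g ‖ξ‖ • innerSL ℝ (‖ξ‖⁻¹ • ξ)) ξ := by
    intro ξ
    rcases eq_or_ne ξ 0 with rfl | hξ
    · have h0 : HasDerivAt g 0 0 := by
        simpa only [hg0] using (hgd 0).hasDerivAt
      rw [hasDerivAt_iff_isLittleO] at h0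
      rw [hasFDerivAt_iff_isLittleO]
      have h1 : Filter.Tendsto (fun ξ : K => ‖ξ‖) (𝓝 0) (𝓝 0) := by
        simpa using (continuous_norm (E := K)).tendsto 0
      have h2 := h0.comp_tendsto h1
      simpa [Function.comp_def] using Asymptotics.isLittleO_norm_right.1
        (h2.congr_right fun ξ => sub_zero ‖ξ‖)
    · have h := (hgd ‖ξ‖).hasDerivAt.comp_hasFDerivAt ξ (hasFDerivAt_norm_of_ne_zero hξ)
      simpa [Function.comp_def] using h
  refine ⟨fun ξ => (hder ξ).differentiableAt, fun R => ?_⟩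
  obtain ⟨L, hL⟩ := (isCompact_Icc (a := (0 : ℝ)) (b := R)).exists_bound_of_continuousOn
    (hg'.continuous_deriv le_rfl).continuousOn
  have hlip : ∀ s ∈ Icc 0 R, ∀ t ∈ Icc 0 R, ‖deriv g s - deriv g t‖ ≤ max L 0 * ‖s - t‖ := by
    intro s hs t ht
    exact (convex_Icc 0 R).norm_image_sub_le_of_norm_deriv_le (𝕜 := ℝ)
      (fun x _ => (hg'.differentiable one_ne_zero) x)
      (fun x hx => (hL x hx).trans (le_max_left _ _)) ht hs
  refine ⟨3 * max L 0, by positivity, fun ξ η hξ hη => ?_⟩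
  rw [(hder ξ).fderiv, (hder η).fderiv]
  have hsplit : deriv g ‖ξ‖ • innerSL ℝ (‖ξ‖⁻¹ • ξ) - deriv g ‖η‖ • innerSL ℝ (‖η‖⁻¹ • η) =
      innerSL ℝ ((deriv g ‖ξ‖ - deriv g ‖η‖) • (‖ξ‖⁻¹ • ξ) +
        deriv g ‖η‖ • (‖ξ‖⁻¹ • ξ - ‖η‖⁻¹ • η)) := by
    rw [← map_smul, ← map_smul, ← map_sub]
    congr 1
    rw [sub_smul, smul_sub]
    abel
  have hR : 0 ≤ R := (norm_nonneg _).trans hξ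
  have h1 := hlip ‖ξ‖ ⟨norm_nonneg _, hξ⟩ ‖η‖ ⟨norm_nonneg _, hη⟩
  have h2 := hlip ‖η‖ ⟨norm_nonneg _, hη⟩ 0 ⟨le_rfl, hR⟩
  rw [hg0, sub_zero, sub_zero, norm_norm] at h2
  rw [hsplit, innerSL_apply_norm]
  calc _ ≤ ‖deriv g ‖ξ‖ - deriv g ‖η‖‖ * ‖‖ξ‖⁻¹ • ξ‖ +
        ‖deriv g ‖η‖‖ * ‖‖ξ‖⁻¹ • ξ - ‖η‖⁻¹ • η‖ := by
        rw [← norm_smul, ← norm_smul]; exact norm_add_le _ _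
    _ ≤ max L 0 * ‖ξ - η‖ * 1 + max L 0 * ‖η‖ * ‖‖ξ‖⁻¹ • ξ - ‖η‖⁻¹ • η‖ := by
        gcongr
        · exact h1.trans (by gcongr; exact abs_norm_sub_norm_le ξ η)
        · exact norm_inv_norm_smul_le_one ξ
    _ ≤ max L 0 * ‖ξ - η‖ * 1 + max L 0 * (2 * ‖ξ - η‖) := by
        rw [mul_assoc (max L 0) ‖η‖]
        exact add_le_add le_rfl (mul_le_mul_of_nonneg_left
          (norm_mul_norm_unit_sub_unit_le ξ η) (le_max_right _ _))
    _ = 3 * max L 0 * ‖ξ - η‖ := by ring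

end Radial

/-! ### The mollified modulus -/

section MollAbs

variable (P : Model)

lemma Model.contDiff_mollAbs : ContDiff ℝ 2 P.mollAbs := by
  have hn : (P.n : ℝ) ≠ 0 := Nat.cast_ne_zero.2 (Nat.one_le_iff_ne_zero.1 P.one_le_n)
  have hφc : HasCompactSupport P.φ :=
    (isCompact_closedBall (0 : ℝ) 1).of_isClosed_subset (isClosed_tsupport _)
      (P.φ_support.trans Metric.ball_subset_closedBall)
  have hc : HasCompactSupport P.moll := by
    have h1 : HasCompactSupport (fun x => P.φ (P.n * x)) :=
      hφc.comp_homeomorph (Homeomorph.mulLeft₀ (P.n : ℝ) hn)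
    exact h1.mul_left
  have hs : ContDiff ℝ (2 : ℕ∞) P.moll :=
    contDiff_const.mul ((P.φ_smooth.of_le (by exact_mod_cast le_top)).comp
      (contDiff_const.mul contDiff_id))
  exact hc.contDiff_convolution_left (ContinuousLinearMap.mul ℝ ℝ) hs
    continuous_abs.locallyIntegrable

lemma Model.deriv_mollAbs_zero : deriv P.mollAbs 0 = 0 := by
  have heven : ∀ x, P.mollAbs (-x) = P.mollAbs x := fun x =>
    convolution_neg_of_neg_eq (ContinuousLinearMap.mul ℝ ℝ)
      (Filter.Eventually.of_forall fun x => by simp [Model.moll, P.φ_even])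
      (Filter.Eventually.of_forall fun x => abs_neg x)
  have h := deriv_comp_neg P.mollAbs 0
  simp only [heven, neg_zero] at h
  linarith

end MollAbs

/-! ### The triangles of the mesh -/

section Geometry

/-- The interior of `halfCell`, relative to the open unit cell. -/
def halfCellInterior (d b : Bool) (s t : ℝ) : Prop :=
  match d, b with
  | false, false => s + t < 1
  | false, true => 1 < s + t
  | true, false => t < s
  | true, true => s < t

lemma halfCellInterior.halfCell {d b : Bool} {s t : ℝ} (h : halfCellInterior d b s t) :
    halfCell d b s t := by
  cases d <;> cases b <;> exact le_of_lt h

lemma exists_halfCell (d : Bool) (s t : ℝ) : ∃ b, halfCell d b s t := by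
  cases d
  · exact (le_total (s + t) 1).elim (fun h => ⟨false, h⟩) fun h => ⟨true, h⟩
  · exact (le_total t s).elim (fun h => ⟨false, h⟩) fun h => ⟨true, h⟩

lemma exists_halfCellInterior (d : Bool) {s t : ℝ} (h1 : s + t ≠ 1) (h2 : s ≠ t) :
    ∃ b, halfCellInterior d b s t := by
  cases d
  · exact h1.lt_or_gt.elim (fun h => ⟨false, h⟩) fun h => ⟨true, h⟩
  · exact h2.symm.lt_or_gt.elim (fun h => ⟨false, h⟩) fun h => ⟨true, h⟩

lemma halfCell.combo {d b : Bool} {s t s' t' r : ℝ} (h : halfCell d b s t)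
    (h' : halfCellInterior d b s' t') (hr0 : 0 < r) (hr1 : r ≤ 1) :
    halfCellInterior d b ((1 - r) * s + r * s') ((1 - r) * t + r * t') := by
  have hr1' : 0 ≤ 1 - r := by linarith
  cases d <;> cases b <;> simp only [halfCell, halfCellInterior] at h h' ⊢ <;>
    nlinarith [mul_le_mul_of_nonneg_left h hr1', mul_lt_mul_of_pos_left h' hr0]

lemma combo_mem_Ioo {s s' r : ℝ} (hs : s ∈ Icc (0 : ℝ) 1) (hs' : s' ∈ Ioo (0 : ℝ) 1) (hr0 : 0 < r)
    (hr1 : r ≤ 1) : (1 - r) * s + r * s' ∈ Ioo (0 : ℝ) 1 := by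
  have hr1' : 0 ≤ 1 - r := by linarith
  constructor <;> nlinarith [mul_nonneg hr1' hs.1, mul_pos hr0 hs'.1,
    mul_le_mul_of_nonneg_left hs.2 hr1', mul_lt_mul_of_pos_left hs'.2 hr0]

namespace Mesh

variable (T : Mesh)

/-- The interiors of the triangles of the mesh. -/
def openTriangle (i j : Fin T.Nh) (b : Bool) : Set (ℝ × ℝ) :=
  {p | (T.Nh : ℝ) * p.1 - (i : ℕ) ∈ Ioo (0 : ℝ) 1 ∧ (T.Nh : ℝ) * p.2 - (j : ℕ) ∈ Ioo (0 : ℝ) 1 ∧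
    halfCellInterior (T.diag i j) b ((T.Nh : ℝ) * p.1 - (i : ℕ)) ((T.Nh : ℝ) * p.2 - (j : ℕ))}

/-- The cavity without the edges of the mesh. -/
def offEdges : Set (ℝ × ℝ) := ⋃ (i : Fin T.Nh) (j : Fin T.Nh) (b : Bool), T.openTriangle i j b

lemma mem_offEdges {p : ℝ × ℝ} : p ∈ T.offEdges ↔ ∃ i j b, p ∈ T.openTriangle i j b := by
  simp [offEdges]

lemma Nh_cast_pos : (0 : ℝ) < T.Nh := Nat.cast_pos.2 T.Nh_pos

lemma isOpen_openTriangle (i j : Fin T.Nh) (b : Bool) : IsOpen (T.openTriangle i j b) := by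
  have h1 : Continuous fun p : ℝ × ℝ => (T.Nh : ℝ) * p.1 - (i : ℕ) := by fun_prop
  have h2 : Continuous fun p : ℝ × ℝ => (T.Nh : ℝ) * p.2 - (j : ℕ) := by fun_prop
  refine (isOpen_Ioo.preimage h1).inter ((isOpen_Ioo.preimage h2).inter ?_)
  change IsOpen {p : ℝ × ℝ | halfCellInterior (T.diag i j) b ((T.Nh : ℝ) * p.1 - (i : ℕ))
    ((T.Nh : ℝ) * p.2 - (j : ℕ))}
  cases T.diag i j <;> cases b
  · exact isOpen_lt (h1.add h2) continuous_const
  · exact isOpen_lt continuous_const (h1.add h2)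
  · exact isOpen_lt h2 h1
  · exact isOpen_lt h1 h2

lemma isOpen_offEdges : IsOpen T.offEdges :=
  isOpen_iUnion fun i => isOpen_iUnion fun j => isOpen_iUnion fun b => T.isOpen_openTriangle i j b

lemma openTriangle_subset (i j : Fin T.Nh) (b : Bool) :
    T.openTriangle i j b ⊆ T.triangle i j b :=
  fun _ hp => ⟨Ioo_subset_Icc_self hp.1, Ioo_subset_Icc_self hp.2.1, hp.2.2.halfCell⟩

lemma mem_Ioo_of_cell {i : Fin T.Nh} {x : ℝ} (h : (T.Nh : ℝ) * x - (i : ℕ) ∈ Ioo (0 : ℝ) 1) :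
    x ∈ Ioo (0 : ℝ) 1 := by
  have hN := T.Nh_cast_pos
  have hi : ((i : ℕ) : ℝ) + 1 ≤ T.Nh := by exact_mod_cast i.2
  have hi0 : (0 : ℝ) ≤ (i : ℕ) := Nat.cast_nonneg _
  constructor
  · by_contra hx
    nlinarith [h.1]
  · by_contra hx
    nlinarith [h.2]

lemma offEdges_subset : T.offEdges ⊆ cavity := by
  intro p hp
  obtain ⟨i, j, b, hp⟩ := T.mem_offEdges.1 hp
  exact ⟨T.mem_Ioo_of_cell hp.1, T.mem_Ioo_of_cell hp.2.1⟩

lemma offEdges_subset_closed : T.offEdges ⊆ closedCavity := fun _ hp =>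
  ⟨Ioo_subset_Icc_self (T.offEdges_subset hp).1, Ioo_subset_Icc_self (T.offEdges_subset hp).2⟩

lemma exists_cell {x : ℝ} (hx : x ∈ Icc (0 : ℝ) 1) :
    ∃ i : Fin T.Nh, (T.Nh : ℝ) * x - (i : ℕ) ∈ Icc (0 : ℝ) 1 := by
  have hN := T.Nh_cast_pos
  have h0 : 0 ≤ (T.Nh : ℝ) * x := mul_nonneg hN.le hx.1
  rcases hx.2.eq_or_lt with rfl | h1
  · refine ⟨⟨T.Nh - 1, Nat.sub_lt T.Nh_pos one_pos⟩, ?_⟩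
    simp [Nat.cast_sub (show 1 ≤ T.Nh from T.Nh_pos)]
  · refine ⟨⟨⌊(T.Nh : ℝ) * x⌋₊, (Nat.floor_lt h0).2 (by nlinarith)⟩, ?_, ?_⟩
    · linarith [Nat.floor_le h0]
    · linarith [Nat.lt_floor_add_one ((T.Nh : ℝ) * x)]

lemma exists_mem_triangle {p : ℝ × ℝ} (hp : p ∈ closedCavity) :
    ∃ i j b, p ∈ T.triangle i j b := by
  obtain ⟨i, hi⟩ := T.exists_cell hp.1
  obtain ⟨j, hj⟩ := T.exists_cell hp.2
  obtain ⟨b, hb⟩ := exists_halfCell (T.diag i j) ((T.Nh : ℝ) * p.1 - (i : ℕ))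
    ((T.Nh : ℝ) * p.2 - (j : ℕ))
  exact ⟨i, j, b, hi, hj, hb⟩

lemma openTriangle_nonempty (i j : Fin T.Nh) (b : Bool) : (T.openTriangle i j b).Nonempty := by
  have hN := T.Nh_cast_pos.ne'
  have key : ∀ s t : ℝ, s ∈ Ioo (0 : ℝ) 1 → t ∈ Ioo (0 : ℝ) 1 →
      halfCellInterior (T.diag i j) b s t → (T.openTriangle i j b).Nonempty := by
    intro s t hs ht h
    refine ⟨(((i : ℕ) + s) / T.Nh, ((j : ℕ) + t) / T.Nh), ?_⟩
    simp only [openTriangle, mem_ofPred_eq, mul_div_cancel₀ _ hN, add_sub_cancel_left]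
    exact ⟨hs, ht, h⟩
  cases hd : T.diag i j <;> cases b <;> rw [hd] at key
  · exact key (1 / 3) (1 / 3) (by norm_num) (by norm_num) (by norm_num [halfCellInterior])
  · exact key (2 / 3) (2 / 3) (by norm_num) (by norm_num) (by norm_num [halfCellInterior])
  · exact key (2 / 3) (1 / 3) (by norm_num) (by norm_num) (by norm_num [halfCellInterior])
  · exact key (1 / 3) (2 / 3) (by norm_num) (by norm_num) (by norm_num [halfCellInterior])

lemma offEdges_nonempty : T.offEdges.Nonempty := by
  obtain ⟨p, hp⟩ := T.openTriangle_nonempty ⟨0, T.Nh_pos⟩ ⟨0, T.Nh_pos⟩ true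
  exact ⟨p, T.mem_offEdges.2 ⟨_, _, _, hp⟩⟩

/-- Half-open segments from a point of a closed triangle to an interior point stay inside. -/
lemma combo_mem_openTriangle {i j : Fin T.Nh} {b : Bool} {p c : ℝ × ℝ} (hp : p ∈ T.triangle i j b)
    (hc : c ∈ T.openTriangle i j b) {r : ℝ} (hr0 : 0 < r) (hr1 : r ≤ 1) :
    p + r • (c - p) ∈ T.openTriangle i j b := by
  have h1 : (T.Nh : ℝ) * (p + r • (c - p)).1 - (i : ℕ) =
      (1 - r) * ((T.Nh : ℝ) * p.1 - (i : ℕ)) + r * ((T.Nh : ℝ) * c.1 - (i : ℕ)) := by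
    simp only [Prod.fst_add, Prod.smul_fst, Prod.fst_sub, smul_eq_mul]; ring
  have h2 : (T.Nh : ℝ) * (p + r • (c - p)).2 - (j : ℕ) =
      (1 - r) * ((T.Nh : ℝ) * p.2 - (j : ℕ)) + r * ((T.Nh : ℝ) * c.2 - (j : ℕ)) := by
    simp only [Prod.snd_add, Prod.smul_snd, Prod.snd_sub, smul_eq_mul]; ring
  simp only [openTriangle, mem_ofPred_eq, h1, h2]
  exact ⟨combo_mem_Ioo hp.1 hc.1 hr0 hr1, combo_mem_Ioo hp.2.1 hc.2.1 hr0 hr1,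
    hp.2.2.combo hc.2.2 hr0 hr1⟩

end Mesh

lemma volume_line (a b c : ℝ) (h : a ≠ 0 ∨ b ≠ 0) :
    volume {p : ℝ × ℝ | a * p.1 + b * p.2 = c} = 0 := by
  let s : AffineSubspace ℝ (ℝ × ℝ) :=
    { carrier := {p : ℝ × ℝ | a * p.1 + b * p.2 = c}
      smul_vsub_vadd_mem' := by
        intro r p q w hp hq hw
        simp only [mem_ofPred_eq, vsub_eq_sub, vadd_eq_add, Prod.fst_add, Prod.smul_fst,
          Prod.fst_sub, Prod.snd_add, Prod.smul_snd, Prod.snd_sub, smul_eq_mul] at hp hq hw ⊢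
        linear_combination r * hp - r * hq + hw }
  refine Measure.addHaar_affineSubspace volume s fun hs => ?_
  have h0 : ∀ p : ℝ × ℝ, a * p.1 + b * p.2 = c := fun p => by
    have : p ∈ s := hs ▸ AffineSubspace.mem_top ℝ (ℝ × ℝ) p
    exact this
  have h1 := h0 (0, 0)
  have h2 := h0 (1, 0)
  have h3 := h0 (0, 1)
  simp only [mul_zero, mul_one, add_zero, zero_add] at h1 h2 h3
  rcases h with h | h
  · exact h (h2.trans h1.symm)
  · exact h (h3.trans h1.symm)

/-- The edges of the mesh lie on the lines on which `N_h x`, `N_h y`, `N_h (x + y)` or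
`N_h (x - y)` is an integer. -/
lemma volume_cavity_diff_offEdges (T : Mesh) : volume (cavity \ T.offEdges) = 0 := by
  have hN := T.Nh_cast_pos.ne'
  have hsub : cavity \ T.offEdges ⊆ ⋃ k : ℤ,
      (({p : ℝ × ℝ | (T.Nh : ℝ) * p.1 + 0 * p.2 = k} ∪
        {p : ℝ × ℝ | 0 * p.1 + (T.Nh : ℝ) * p.2 = k}) ∪
      ({p : ℝ × ℝ | (T.Nh : ℝ) * p.1 + (T.Nh : ℝ) * p.2 = k} ∪
        {p : ℝ × ℝ | (T.Nh : ℝ) * p.1 + (-(T.Nh : ℝ)) * p.2 = k})) := by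
    rintro p ⟨hp, hpo⟩
    by_contra hcon
    simp only [mem_iUnion, mem_union, mem_ofPred_eq, not_exists, not_or, zero_mul, add_zero,
      zero_add] at hcon
    refine hpo ?_
    obtain ⟨i, hi⟩ := T.exists_cell (Ioo_subset_Icc_self hp.1)
    obtain ⟨j, hj⟩ := T.exists_cell (Ioo_subset_Icc_self hp.2)
    obtain ⟨b, hb⟩ := exists_halfCellInterior (T.diag i j) (s := (T.Nh : ℝ) * p.1 - (i : ℕ))
      (t := (T.Nh : ℝ) * p.2 - (j : ℕ))
      (fun h => (hcon ((i : ℕ) + (j : ℕ) + 1)).2.1 (by push_cast; linarith))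
      (fun h => (hcon ((i : ℕ) - (j : ℕ))).2.2 (by push_cast; linarith))
    refine T.mem_offEdges.2 ⟨i, j, b, ⟨lt_of_le_of_ne hi.1 fun h => ?_,
      lt_of_le_of_ne hi.2 fun h => ?_⟩, ⟨lt_of_le_of_ne hj.1 fun h => ?_,
      lt_of_le_of_ne hj.2 fun h => ?_⟩, hb⟩
    · exact (hcon (i : ℕ)).1.1 (by push_cast; linarith)
    · exact (hcon ((i : ℕ) + 1)).1.1 (by push_cast; linarith)
    · exact (hcon (j : ℕ)).1.2 (by push_cast; linarith)
    · exact (hcon ((j : ℕ) + 1)).1.2 (by push_cast; linarith)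
  refine measure_mono_null hsub (measure_iUnion_null fun k => ?_)
  refine measure_union_null (measure_union_null ?_ ?_) (measure_union_null ?_ ?_)
  · exact volume_line _ _ _ (Or.inl hN)
  · exact volume_line _ _ _ (Or.inr hN)
  · exact volume_line _ _ _ (Or.inl hN)
  · exact volume_line _ _ _ (Or.inl hN)

end Geometry

/-! ### Finite element functions off the mesh edges -/

section FESpace

variable {T : Mesh} {k : ℕ} {v : ℝ × ℝ → ℝ}

lemma contDiff_eval_mvPolynomial (P : MvPolynomial (Fin 2) ℝ) :
    ContDiff ℝ 1 fun p : ℝ × ℝ => MvPolynomial.eval ![p.1, p.2] P := by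
  induction P using MvPolynomial.induction_on with
  | C a => simpa using contDiff_const
  | add P Q hP hQ => simpa using hP.add hQ
  | mul_X P i hP =>
    have : ContDiff ℝ 1 fun p : ℝ × ℝ => (![p.1, p.2] : Fin 2 → ℝ) i := by
      fin_cases i
      · exact contDiff_fst
      · exact contDiff_snd
    simpa using hP.mul this

lemma exists_contDiff_eqOn (hv : v ∈ feSpace T k) (i j : Fin T.Nh) (b : Bool) :
    ∃ e : ℝ × ℝ → ℝ, ContDiff ℝ 1 e ∧ ∀ p ∈ T.triangle i j b, v p = e p := by
  obtain ⟨P, -, hP⟩ := hv.2.2 i j b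
  exact ⟨_, contDiff_eval_mvPolynomial P, hP⟩

lemma eventuallyEq_of_mem_openTriangle {i j : Fin T.Nh} {b : Bool} {e : ℝ × ℝ → ℝ}
    (he : ∀ p ∈ T.triangle i j b, v p = e p) {p : ℝ × ℝ} (hp : p ∈ T.openTriangle i j b) :
    v =ᶠ[𝓝 p] e :=
  Filter.eventually_of_mem ((T.isOpen_openTriangle i j b).mem_nhds hp)
    fun q hq => he q (T.openTriangle_subset i j b hq)

lemma differentiableAt_of_mem_feSpace (hv : v ∈ feSpace T k) {p : ℝ × ℝ} (hp : p ∈ T.offEdges) :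
    DifferentiableAt ℝ v p := by
  obtain ⟨i, j, b, hp⟩ := T.mem_offEdges.1 hp
  obtain ⟨e, hec, he⟩ := exists_contDiff_eqOn hv i j b
  exact ((hec.differentiable one_ne_zero) p).congr_of_eventuallyEq
    (eventuallyEq_of_mem_openTriangle he hp)

lemma continuousOn_fderiv_of_mem_feSpace (hv : v ∈ feSpace T k) :
    ContinuousOn (fderiv ℝ v) T.offEdges := by
  intro p hp
  obtain ⟨i, j, b, hp⟩ := T.mem_offEdges.1 hp
  obtain ⟨e, hec, he⟩ := exists_contDiff_eqOn hv i j b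
  have h := (eventuallyEq_of_mem_openTriangle he hp).fderiv (𝕜 := ℝ)
  exact (((hec.continuous_fderiv one_ne_zero).continuousAt).congr h.symm).continuousWithinAt

lemma exists_norm_fderiv_le_of_mem_feSpace (hv : v ∈ feSpace T k) :
    ∃ C, ∀ p ∈ T.offEdges, ‖fderiv ℝ v p‖ ≤ C := by
  choose e hec he using exists_contDiff_eqOn hv
  have hb : ∀ i j b, ∃ C, ∀ p ∈ closedCavity, ‖fderiv ℝ (e i j b) p‖ ≤ C := fun i j b =>
    (isCompact_Icc.prod isCompact_Icc).exists_bound_of_continuousOn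
      ((hec i j b).continuous_fderiv one_ne_zero).continuousOn
  choose C hC using hb
  obtain ⟨M, hM⟩ := (Set.finite_range fun x : Fin T.Nh × Fin T.Nh × Bool =>
    C x.1 x.2.1 x.2.2).bddAbove
  refine ⟨M, fun p hp => ?_⟩
  obtain ⟨i, j, b, hp'⟩ := T.mem_offEdges.1 hp
  rw [(eventuallyEq_of_mem_openTriangle (he i j b) hp').fderiv_eq]
  exact (hC i j b p (T.offEdges_subset_closed hp)).trans (hM ⟨(i, j, b), rfl⟩)

/-- A finite element function with vanishing gradient is constant: it is constant on each closed
triangle, so that its values on the connected set `[0,1]²` are finite in number. -/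
lemma eq_of_fderiv_eq_zero (hv : v ∈ feSpace T k) (h0 : ∀ p ∈ T.offEdges, fderiv ℝ v p = 0)
    {p q : ℝ × ℝ} (hp : p ∈ closedCavity) (hq : q ∈ closedCavity) : v p = v q := by
  choose c hc using T.openTriangle_nonempty
  have hconst : ∀ i j b, ∀ p ∈ T.triangle i j b, v p = v (c i j b) := by
    intro i j b p hp
    obtain ⟨e, hec, he⟩ := exists_contDiff_eqOn hv i j b
    have hder : ∀ t ∈ Ioo (0 : ℝ) 1,
        HasDerivAt (fun t : ℝ => e (p + t • (c i j b - p))) 0 t := by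
      intro t ht
      have h1 : HasDerivAt (fun t : ℝ => p + t • (c i j b - p)) (c i j b - p) t := by
        simpa using ((hasDerivAt_id t).smul_const (c i j b - p)).const_add p
      have hm := T.combo_mem_openTriangle hp (hc i j b) ht.1 ht.2.le
      have h2 : fderiv ℝ e (p + t • (c i j b - p)) = 0 := by
        rw [← (eventuallyEq_of_mem_openTriangle he hm).fderiv_eq]
        exact h0 _ (T.mem_offEdges.2 ⟨i, j, b, hm⟩)
      have h3 := ((hec.differentiable one_ne_zero)
        (p + t • (c i j b - p))).hasFDerivAt.comp_hasDerivAt t h1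
      rwa [h2] at h3
    have hcont : Continuous (fun t : ℝ => e (p + t • (c i j b - p))) :=
      hec.continuous.comp (by fun_prop)
    obtain ⟨s, -, hse⟩ := exists_hasDerivAt_eq_slope _ _ zero_lt_one hcont.continuousOn hder
    rw [he p hp, he _ (T.openTriangle_subset i j b (hc i j b))]
    simp only [zero_smul, add_zero, one_smul, add_sub_cancel, sub_zero, div_one] at hse
    linarith
  have hfin : (v '' closedCavity).Finite := by
    refine (Set.finite_range fun x : Fin T.Nh × Fin T.Nh × Bool =>
      v (c x.1 x.2.1 x.2.2)).subset ?_
    rintro _ ⟨p, hp, rfl⟩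
    obtain ⟨i, j, b, hp⟩ := T.exists_mem_triangle hp
    exact ⟨(i, j, b), (hconst i j b p hp).symm⟩
  have hconn : IsPreconnected (v '' closedCavity) :=
    (isPreconnected_Icc.prod isPreconnected_Icc).image v hv.1
  by_contra hne
  exact hconn.infinite_of_nontrivial
    ⟨v p, mem_image_of_mem v hp, v q, mem_image_of_mem v hq, hne⟩ hfin

lemma eq_zero_of_fderiv_eq_zero (hv : v ∈ feSpace T k) (h0 : ∀ p ∈ T.offEdges, fderiv ℝ v p = 0)
    {q : ℝ × ℝ} (hq : q ∈ closedCavity) (hvq : v q = 0) : v = 0 := by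
  funext p
  by_cases hp : p ∈ closedCavity
  · rw [eq_of_fderiv_eq_zero hv h0 hp hq, hvq]; rfl
  · exact hv.2.1 p hp

lemma eq_zero_of_eqOn_zero (hv : v ∈ feSpace T k) (h0 : ∀ p ∈ T.offEdges, v p = 0) : v = 0 := by
  obtain ⟨q, hq⟩ := T.offEdges_nonempty
  refine eq_zero_of_fderiv_eq_zero hv (fun p hp => ?_) (T.offEdges_subset_closed hq) (h0 q hq)
  have : v =ᶠ[𝓝 p] fun _ => 0 := Filter.eventually_of_mem (T.isOpen_offEdges.mem_nhds hp) h0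
  rw [this.fderiv_eq]
  simp

instance finiteDimensional_feSpace : FiniteDimensional ℝ (feSpace T k) := by
  -- restriction of polynomials to the triangles
  let Ψ : (Fin T.Nh → Fin T.Nh → Bool → MvPolynomial.restrictTotalDegree (Fin 2) ℝ k) →ₗ[ℝ]
      ((i j : Fin T.Nh) → (b : Bool) → T.triangle i j b → ℝ) :=
    { toFun := fun P i j b p =>
        MvPolynomial.eval ![(p : ℝ × ℝ).1, (p : ℝ × ℝ).2] (P i j b : MvPolynomial (Fin 2) ℝ)
      map_add' := fun P Q => by ext; simp
      map_smul' := fun c P => by ext; simp [MvPolynomial.smul_eval] }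
  let ρ : feSpace T k →ₗ[ℝ] ((i j : Fin T.Nh) → (b : Bool) → T.triangle i j b → ℝ) :=
    { toFun := fun v _ _ _ p => (v : ℝ × ℝ → ℝ) p
      map_add' := fun _ _ => rfl
      map_smul' := fun _ _ => rfl }
  have hρ : ∀ v, ρ v ∈ LinearMap.range Ψ := by
    intro v
    choose P hP hPe using v.2.2.2
    refine ⟨fun i j b => ⟨P i j b, (MvPolynomial.mem_restrictTotalDegree _ _ _).2 (hP i j b)⟩, ?_⟩
    funext i j b p
    exact (hPe i j b p p.2).symm
  refine FiniteDimensional.of_injective (ρ.codRestrict (LinearMap.range Ψ) hρ) fun v w hvw => ?_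
  have hvw' : ρ v = ρ w := congrArg Subtype.val hvw
  ext p
  by_cases hp : p ∈ closedCavity
  · obtain ⟨i, j, b, hp⟩ := T.exists_mem_triangle hp
    exact congrFun (congrFun (congrFun (congrFun hvw' i) j) b) ⟨p, hp⟩
  · rw [v.2.2.1 p hp, w.2.2.1 p hp]

end FESpace

/-! ### Bounded continuous functions off the mesh edges, and their integrals -/

section Fields

variable {T : Mesh} {k : ℕ}

/-- The directional derivative of a finite element function as a bounded continuous function off
the mesh edges. -/
def feDeriv (T : Mesh) (k : ℕ) (w : ℝ × ℝ) : feSpace T k →ₗ[ℝ] (T.offEdges →ᵇ ℝ) where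
  toFun v := BoundedContinuousFunction.ofNormedAddCommGroup
    (fun p => fderiv ℝ (v : ℝ × ℝ → ℝ) p w)
    ((continuousOn_iff_continuous_domRestrict.1 (continuousOn_fderiv_of_mem_feSpace v.2)).clm_apply
      continuous_const)
    ((exists_norm_fderiv_le_of_mem_feSpace v.2).choose * ‖w‖)
    (fun p => (ContinuousLinearMap.le_opNorm _ _).trans (mul_le_mul_of_nonneg_right
      ((exists_norm_fderiv_le_of_mem_feSpace v.2).choose_spec p p.2) (norm_nonneg w)))
  map_add' v v' := by
    ext p
    have h := fderiv_add (differentiableAt_of_mem_feSpace v.2 p.2)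
      (differentiableAt_of_mem_feSpace v'.2 p.2)
    exact DFunLike.congr_fun h w
  map_smul' c v := by
    ext p
    have h := fderiv_const_smul (differentiableAt_of_mem_feSpace v.2 p.2) c
    exact DFunLike.congr_fun h w

lemma feDeriv_apply (w : ℝ × ℝ) (v : feSpace T k) (p : T.offEdges) :
    feDeriv T k w v p = fderiv ℝ (v : ℝ × ℝ → ℝ) p w := rfl

lemma exists_norm_le_of_mem_feSpace {v : ℝ × ℝ → ℝ} (hv : v ∈ feSpace T k) :
    ∃ C, ∀ p ∈ closedCavity, ‖v p‖ ≤ C :=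
  (isCompact_Icc.prod isCompact_Icc).exists_bound_of_continuousOn hv.1

/-- A finite element function as a bounded continuous function off the mesh edges. -/
def feVal (T : Mesh) (k : ℕ) : feSpace T k →ₗ[ℝ] (T.offEdges →ᵇ ℝ) where
  toFun v := BoundedContinuousFunction.ofNormedAddCommGroup (fun p => (v : ℝ × ℝ → ℝ) p)
    (continuousOn_iff_continuous_domRestrict.1 (v.2.1.mono T.offEdges_subset_closed))
    (exists_norm_le_of_mem_feSpace v.2).choose
    (fun p => (exists_norm_le_of_mem_feSpace v.2).choose_spec p (T.offEdges_subset_closed p.2))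
  map_add' _ _ := by ext p; rfl
  map_smul' _ _ := by ext p; rfl

lemma dx_eq_feDeriv (v : feSpace T k) (p : T.offEdges) :
    dx (v : ℝ × ℝ → ℝ) p = feDeriv T k (1, 0) v p := by
  have h1 : HasDerivAt (fun s : ℝ => (s, (p : ℝ × ℝ).2)) (1, 0) (p : ℝ × ℝ).1 :=
    (hasDerivAt_id _).prodMk (hasDerivAt_const _ _)
  exact ((differentiableAt_of_mem_feSpace v.2 p.2).hasFDerivAt.comp_hasDerivAt
    (p : ℝ × ℝ).1 h1).deriv

lemma dy_eq_feDeriv (v : feSpace T k) (p : T.offEdges) :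
    dy (v : ℝ × ℝ → ℝ) p = feDeriv T k (0, 1) v p := by
  have h1 : HasDerivAt (fun s : ℝ => ((p : ℝ × ℝ).1, s)) (0, 1) (p : ℝ × ℝ).2 :=
    (hasDerivAt_const _ _).prodMk (hasDerivAt_id _)
  exact ((differentiableAt_of_mem_feSpace v.2 p.2).hasFDerivAt.comp_hasDerivAt
    (p : ℝ × ℝ).2 h1).deriv

lemma eq_zero_of_feDeriv_eq_zero (v : feSpace T k) (hx : feDeriv T k (1, 0) v = 0)
    (hy : feDeriv T k (0, 1) v = 0) {q : ℝ × ℝ} (hq : q ∈ closedCavity)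
    (hvq : (v : ℝ × ℝ → ℝ) q = 0) : (v : ℝ × ℝ → ℝ) = 0 := by
  refine eq_zero_of_fderiv_eq_zero v.2 (fun p hp => ?_) hq hvq
  have h1 := DFunLike.congr_fun hx ⟨p, hp⟩
  have h2 := DFunLike.congr_fun hy ⟨p, hp⟩
  simp only [feDeriv_apply, BoundedContinuousFunction.coe_zero, Pi.zero_apply] at h1 h2
  ext
  · simpa using h1
  · simpa using h2

lemma eq_zero_of_feVal_eq_zero (v : feSpace T k) (h : feVal T k v = 0) :
    (v : ℝ × ℝ → ℝ) = 0 :=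
  eq_zero_of_eqOn_zero v.2 fun p hp => DFunLike.congr_fun h ⟨p, hp⟩

/-- Lebesgue measure on the cavity without the mesh edges. -/
def offEdgesMeasure (T : Mesh) : Measure T.offEdges := volume.comap Subtype.val

lemma volume_offEdges_lt_top (T : Mesh) : volume T.offEdges < ⊤ :=
  (measure_mono T.offEdges_subset_closed).trans_lt
    (isCompact_Icc.prod isCompact_Icc).measure_lt_top

instance (T : Mesh) : IsFiniteMeasure (offEdgesMeasure T) := by
  refine ⟨?_⟩
  rw [offEdgesMeasure, Measure.comap_apply _ Subtype.val_injective
    (fun s hs => T.isOpen_offEdges.measurableSet.subtype_image hs) _ MeasurableSet.univ]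
  simpa using volume_offEdges_lt_top T

instance (T : Mesh) : (offEdgesMeasure T).IsOpenPosMeasure :=
  Measure.IsOpenPosMeasure.comap volume T.isOpen_offEdges.isOpenEmbedding_subtypeVal

/-- Integration over the cavity, as a functional on the bounded continuous functions off the mesh
edges. -/
def cavityIntegral (T : Mesh) : (T.offEdges →ᵇ ℝ) →L[ℝ] ℝ :=
  LinearMap.mkContinuous
    { toFun := fun f => ∫ p, f p ∂offEdgesMeasure T
      map_add' := fun f g => integral_add (f.integrable _) (g.integrable _)
      map_smul' := fun c _ => integral_const_mul c _ }
    ((offEdgesMeasure T).real univ)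
    (fun _ => BoundedContinuousFunction.norm_integral_le_mul_norm _ _)

lemma cavityIntegral_apply (f : T.offEdges →ᵇ ℝ) :
    cavityIntegral T f = ∫ p, f p ∂offEdgesMeasure T := rfl

/-- An integrand need only be identified off the edges, where the partial derivatives `dx` and `dy`
have no junk values. -/
lemma setIntegral_cavity_eq (F : T.offEdges →ᵇ ℝ) {f : ℝ × ℝ → ℝ}
    (h : ∀ p : T.offEdges, f p = F p) : ∫ p in cavity, f p = cavityIntegral T F := by
  have hae : (cavity : Set (ℝ × ℝ)) =ᵐ[volume] T.offEdges :=
    Filter.EventuallyLE.antisymm (ae_le_set.2 (volume_cavity_diff_offEdges T))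
      T.offEdges_subset.eventuallyLE
  rw [setIntegral_congr_set hae, ← integral_subtype_comap T.isOpen_offEdges.measurableSet,
    cavityIntegral_apply]
  exact integral_congr_ae (Filter.Eventually.of_forall h)

lemma cavityIntegral_mul_self_nonneg (f : T.offEdges →ᵇ ℝ) : 0 ≤ cavityIntegral T (f * f) :=
  integral_nonneg fun p => mul_self_nonneg (f p)

lemma eq_zero_of_cavityIntegral_mul_self {f : T.offEdges →ᵇ ℝ}
    (h : cavityIntegral T (f * f) = 0) : f = 0 := by
  replace h := (integral_eq_zero_iff_of_nonneg (μ := offEdgesMeasure T)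
    (fun p => mul_self_nonneg (f p)) ((f * f).integrable _)).1 h
  have h1 := ((f * f).continuous.ae_eq_iff_eq (offEdgesMeasure T) continuous_const).1 h
  ext p
  exact mul_self_eq_zero.1 (congrFun h1 p)

lemma feSpace_mono {k k' : ℕ} (h : k ≤ k') : feSpace T k ≤ feSpace T k' := fun _ hv =>
  ⟨hv.1, hv.2.1, fun i j b => (hv.2.2 i j b).imp fun _ hP => ⟨hP.1.trans h, hP.2⟩⟩

/-- A quadruple of bounded continuous functions as a field with values in Euclidean space. -/
def assemble {α : Type*} [TopologicalSpace α] :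
    (Fin 4 → α →ᵇ ℝ) →ₗ[ℝ] (α →ᵇ EuclideanSpace ℝ (Fin 4)) :=
  ∑ j, (((ContinuousLinearMap.toSpanSingleton ℝ
    (EuclideanSpace.single j (1 : ℝ))).compLeftContinuousBounded α).toLinearMap).comp
      (LinearMap.proj j)

lemma assemble_apply {α : Type*} [TopologicalSpace α] (f : Fin 4 → α →ᵇ ℝ) (ω : α) (j : Fin 4) :
    assemble f ω j = f j ω := by
  simp [assemble, LinearMap.sum_apply, BoundedContinuousFunction.sum_apply, EuclideanSpace.single,
    Pi.single_apply]

end Fields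

/-! ### The normed product space -/

/-- The product space of the discrete problem, without the topology of pointwise convergence that
its description as a space of functions carries; it is normed by `Model.normX`. -/
def XE (P : Model) : Type := Xh P.toDiscretization

namespace XE

variable {P : Model}

-- The low priority makes instance search prefer the structures derived from the norm.
instance (priority := 10) : AddCommGroup (XE P) :=
  inferInstanceAs (AddCommGroup (Xh P.toDiscretization))

instance (priority := 10) : Module ℝ (XE P) :=
  inferInstanceAs (Module ℝ (Xh P.toDiscretization))

section Components

/-- The first velocity component. -/
def vel₁ : XE P →ₗ[ℝ] feSpace P.toMesh P.l where
  toFun U := ⟨U.1.1, U.1.1.2.1⟩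
  map_add' _ _ := rfl
  map_smul' _ _ := rfl

/-- The second velocity component. -/
def vel₂ : XE P →ₗ[ℝ] feSpace P.toMesh P.l where
  toFun U := ⟨U.1.2, U.1.2.2.1⟩
  map_add' _ _ := rfl
  map_smul' _ _ := rfl

/-- The temperature. -/
def temp : XE P →ₗ[ℝ] feSpace P.toMesh P.q where
  toFun U := ⟨U.2.1, U.2.1.2.1⟩
  map_add' _ _ := rfl
  map_smul' _ _ := rfl

/-- The pressure. -/
def pres : XE P →ₗ[ℝ] feSpace P.toMesh P.m where
  toFun U := ⟨U.2.2, U.2.2.2.1⟩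
  map_add' _ _ := rfl
  map_smul' _ _ := rfl

/-- The large-scale part of the first velocity component. -/
def large₁ : XE P →ₗ[ℝ] feSpace P.toMesh P.l where
  toFun U := ⟨(P.interpY U.1).1, feSpace_mono (Nat.sub_le _ _) (P.interpY U.1).1.2.1⟩
  map_add' U V := Subtype.ext (congrArg (fun w => (w.1 : Sc)) (P.interpY.map_add U.1 V.1))
  map_smul' c U := Subtype.ext (congrArg (fun w => (w.1 : Sc)) (P.interpY.map_smul c U.1))

/-- The large-scale part of the second velocity component. -/
def large₂ : XE P →ₗ[ℝ] feSpace P.toMesh P.l where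
  toFun U := ⟨(P.interpY U.1).2, feSpace_mono (Nat.sub_le _ _) (P.interpY U.1).2.2.1⟩
  map_add' U V := Subtype.ext (congrArg (fun w => (w.2 : Sc)) (P.interpY.map_add U.1 V.1))
  map_smul' c U := Subtype.ext (congrArg (fun w => (w.2 : Sc)) (P.interpY.map_smul c U.1))

/-- The large-scale part of the temperature. -/
def largeθ : XE P →ₗ[ℝ] feSpace P.toMesh P.q where
  toFun U := ⟨(P.interpθ U.2.1 : Sc), feSpace_mono (Nat.sub_le _ _) (P.interpθ U.2.1).2.1⟩
  map_add' U V := Subtype.ext (congrArg (fun w : ΘhBar P.toDiscretization => (w : Sc))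
    (P.interpθ.map_add U.2.1 V.2.1))
  map_smul' c U := Subtype.ext (congrArg (fun w : ΘhBar P.toDiscretization => (w : Sc))
    (P.interpθ.map_smul c U.2.1))

/-- The small-scale part of the first velocity component. -/
def small₁ : XE P →ₗ[ℝ] feSpace P.toMesh P.l := vel₁ - large₁

/-- The small-scale part of the second velocity component. -/
def small₂ : XE P →ₗ[ℝ] feSpace P.toMesh P.l := vel₂ - large₂

/-- The small-scale part of the temperature. -/
def smallTemp : XE P →ₗ[ℝ] feSpace P.toMesh P.q := temp - largeθ

lemma smallY_fst (U : XE P) : (P.smallY U.1).1 = (small₁ U : Sc) := rfl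

lemma smallY_snd (U : XE P) : (P.smallY U.1).2 = (small₂ U : Sc) := rfl

lemma smallθ_eq (U : XE P) : P.smallθ U.2.1 = (smallTemp U : Sc) := rfl

end Components

/-- The bounded continuous functions off the mesh edges. -/
abbrev Fld (P : Model) : Type := P.toMesh.offEdges →ᵇ ℝ

/-- `∂_x` of a component of the unknown, off the mesh edges. -/
def DX {k : ℕ} (L : XE P →ₗ[ℝ] feSpace P.toMesh k) : XE P →ₗ[ℝ] Fld P :=
  (feDeriv P.toMesh k (1, 0)).comp L

/-- `∂_y` of a component of the unknown, off the mesh edges. -/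
def DY {k : ℕ} (L : XE P →ₗ[ℝ] feSpace P.toMesh k) : XE P →ₗ[ℝ] Fld P :=
  (feDeriv P.toMesh k (0, 1)).comp L

/-- The values of a component of the unknown, off the mesh edges. -/
def VAL {k : ℕ} (L : XE P →ₗ[ℝ] feSpace P.toMesh k) : XE P →ₗ[ℝ] Fld P :=
  (feVal P.toMesh k).comp L

lemma dx_eq {k : ℕ} (L : XE P →ₗ[ℝ] feSpace P.toMesh k) (U : XE P) (p : P.toMesh.offEdges) :
    dx (L U : Sc) p = DX L U p := dx_eq_feDeriv _ p

lemma dy_eq {k : ℕ} (L : XE P →ₗ[ℝ] feSpace P.toMesh k) (U : XE P) (p : P.toMesh.offEdges) :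
    dy (L U : Sc) p = DY L U p := dy_eq_feDeriv _ p

lemma val_eq {k : ℕ} (L : XE P →ₗ[ℝ] feSpace P.toMesh k) (U : XE P) (p : P.toMesh.offEdges) :
    (L U : Sc) p = VAL L U p := rfl

section Norm

/-- The seven fields whose `L²` norms make up the norm of the product space. -/
def normFields : Fin 7 → XE P →ₗ[ℝ] Fld P :=
  ![DX vel₁, DY vel₁, DX vel₂, DY vel₂, DX temp, DY temp, VAL pres]

lemma eq_zero_of_normFields {U : XE P} (h : ∀ i, normFields i U = 0) : U = 0 := by
  -- each component has gradient zero and vanishes at some point of the boundary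
  have hb : ∀ p ∈ cavityBoundary, p ∈ closedCavity := fun p hp => hp.1
  have h00 : ((0, 0) : ℝ × ℝ) ∈ cavityBoundary := by
    simp [cavityBoundary, closedCavity, cavity]
  obtain ⟨q, hq⟩ := P.ΓD_nonempty
  have h1 : (U.1.1 : Sc) = 0 :=
    eq_zero_of_feDeriv_eq_zero (vel₁ U) (h 0) (h 1) (hb _ h00) (U.1.1.2.2 _ h00)
  have h2 : (U.1.2 : Sc) = 0 :=
    eq_zero_of_feDeriv_eq_zero (vel₂ U) (h 2) (h 3) (hb _ h00) (U.1.2.2.2 _ h00)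
  have h3 : (U.2.1 : Sc) = 0 :=
    eq_zero_of_feDeriv_eq_zero (temp U) (h 4) (h 5) (hb _ (P.ΓD_subset hq)) (U.2.1.2.2 _ hq)
  have h4 : (U.2.2 : Sc) = 0 := eq_zero_of_feVal_eq_zero (pres U) (h 6)
  exact Prod.ext (Prod.ext (Subtype.ext h1) (Subtype.ext h2))
    (Prod.ext (Subtype.ext h3) (Subtype.ext h4))

/-- The inner product that induces `Model.normX`. -/
@[reducible] def innerCore : InnerProductSpace.Core ℝ (XE P) where
  inner U V := ∑ i, cavityIntegral P.toMesh (normFields i U * normFields i V)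
  conj_inner_symm U V := by
    simp only [conj_trivial]
    exact Finset.sum_congr rfl fun i _ => by rw [mul_comm]
  re_inner_nonneg U := by
    simpa using Finset.sum_nonneg fun i _ => cavityIntegral_mul_self_nonneg (normFields i U)
  add_left U V W := by
    simp only [map_add, add_mul, Finset.sum_add_distrib]
  smul_left U V c := by
    simp only [map_smul, smul_mul_assoc, smul_eq_mul, Finset.mul_sum, conj_trivial]
  definite U h := by
    rw [Finset.sum_eq_zero_iff_of_nonneg fun i _ => cavityIntegral_mul_self_nonneg _] at h
    exact eq_zero_of_normFields fun i =>
      eq_zero_of_cavityIntegral_mul_self (h i (Finset.mem_univ i))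

instance : NormedAddCommGroup (XE P) := innerCore.toNormedAddCommGroup

instance : InnerProductSpace ℝ (XE P) := InnerProductSpace.ofCore innerCore.toCore

lemma norm_eq_normX (U : XE P) : ‖U‖ = P.normX U := by
  have h0 : ‖U‖ = √(∑ i, cavityIntegral P.toMesh (normFields i U * normFields i U)) := rfl
  rw [h0]
  unfold Model.normX
  congr 1
  rw [setIntegral_cavity_eq (DX vel₁ U * DX vel₁ U + DY vel₁ U * DY vel₁ U +
      DX vel₂ U * DX vel₂ U + DY vel₂ U * DY vel₂ U),
    setIntegral_cavity_eq (DX temp U * DX temp U + DY temp U * DY temp U),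
    setIntegral_cavity_eq (VAL pres U * VAL pres U)]
  · simp only [Fin.sum_univ_succ, map_add, normFields]
    simp
    ring
  · intro p
    rw [show (U.2.2 : Sc) = (pres U : Sc) from rfl, val_eq]
    simp [sq]
  · intro p
    rw [show (U.2.1 : Sc) = (temp U : Sc) from rfl, dx_eq, dy_eq]
    simp [sq]
  · intro p
    rw [show (U.1.1 : Sc) = (vel₁ U : Sc) from rfl, show (U.1.2 : Sc) = (vel₂ U : Sc) from rfl,
      dx_eq, dy_eq, dx_eq, dy_eq]
    simp [sq]

instance : FiniteDimensional ℝ (XE P) := by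
  let L : XE P →ₗ[ℝ] (feSpace P.toMesh P.l × feSpace P.toMesh P.l) ×
      (feSpace P.toMesh P.q × feSpace P.toMesh P.m) :=
    (vel₁.prod vel₂).prod (temp.prod pres)
  refine FiniteDimensional.of_injective L fun U V h => ?_
  exact Prod.ext
    (Prod.ext (Subtype.ext (congrArg (fun w => (w.1.1 : Sc)) h))
      (Subtype.ext (congrArg (fun w => (w.1.2 : Sc)) h)))
    (Prod.ext (Subtype.ext (congrArg (fun w => (w.2.1 : Sc)) h))
      (Subtype.ext (congrArg (fun w => (w.2.2 : Sc)) h)))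

end Norm

/-! ### The operator of the discrete problem -/

section Operator

/-- The scaled gradient of the small-scale velocity, whose modulus is `gradMod`. -/
def gradSmall (μg : ℝ) : XE P →ₗ[ℝ] (P.toMesh.offEdges →ᵇ EuclideanSpace ℝ (Fin 4)) :=
  assemble.comp (LinearMap.pi ![DX small₁, (1 / μg) • DY small₁,
    DX small₂, (1 / μg) • DY small₂])

lemma gradMod_smallY (μg : ℝ) (U : XE P) (p : P.toMesh.offEdges) :
    gradMod μg (P.smallY U.1) p = ‖gradSmall μg U p‖ := by
  rw [gradMod, smallY_fst, smallY_snd, dx_eq, dy_eq, dx_eq, dy_eq, EuclideanSpace.norm_eq,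
    Fin.sum_univ_four]
  simp only [gradSmall, LinearMap.comp_apply, assemble_apply, LinearMap.pi_apply]
  congr 1
  simp [mul_pow, inv_pow]

/-- The coefficient of the eddy viscosity. -/
def eddyCoeff (P : Model) (μg : ℝ) : ℝ := P.CS ^ 2 * ((μg ^ 2 + 1) / (P.Nh : ℝ) ^ 2)

/-- The `j`-th component of `|w| w` for the scaled gradient `w` of the small-scale velocity. -/
def smag (μg : ℝ) (j : Fin 4) (U : XE P) : Fld P :=
  (EuclideanSpace.proj j : EuclideanSpace ℝ (Fin 4) →L[ℝ] ℝ).compLeftContinuousBounded _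
    (superpose (fun ξ : EuclideanSpace ℝ (Fin 4) => ‖ξ‖ • ξ)
      lipDerivOnBalls_norm_smul.1.continuous (gradSmall μg U))

/-- The mollified modulus of the scaled gradient of the small-scale velocity. -/
def smagMoll (μg : ℝ) (U : XE P) : Fld P :=
  superpose (fun ξ : EuclideanSpace ℝ (Fin 4) => P.mollAbs ‖ξ‖)
    (lipDerivOnBalls_comp_norm P.contDiff_mollAbs P.deriv_mollAbs_zero).1.continuous
    (gradSmall μg U)

lemma smag_apply (μg : ℝ) (j : Fin 4) (U : XE P) (p : P.toMesh.offEdges) :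
    smag μg j U p = ‖gradSmall μg U p‖ * gradSmall μg U p j := by
  simp [smag]

lemma smagMoll_apply (μg : ℝ) (U : XE P) (p : P.toMesh.offEdges) :
    smagMoll μg U p = P.mollAbs ‖gradSmall μg U p‖ := rfl

lemma locC11_smag (μg : ℝ) (j : Fin 4) : LocC11 (smag (P := P) μg j) := by
  have h := LocC11.comp (lipDerivOnBalls_norm_smul.locC11_superpose (α := P.toMesh.offEdges))
    (gradSmall (P := P) μg).toContinuousLinearMap.locC11
  exact h.clm _

lemma locC11_smagMoll (μg : ℝ) : LocC11 (smagMoll (P := P) μg) := by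
  have h := LocC11.comp ((lipDerivOnBalls_comp_norm P.contDiff_mollAbs
    P.deriv_mollAbs_zero).locC11_superpose (α := P.toMesh.offEdges))
    (gradSmall (P := P) μg).toContinuousLinearMap.locC11
  exact h

/-- Integration over the cavity. -/
abbrev J : Fld P →L[ℝ] ℝ := cavityIntegral P.toMesh

/-- The operator of the discrete problem, written with products of bounded continuous functions. In
the eddy viscosity term the modulus is absorbed into `smag`; the components `1` and `3` of the
scaled gradient carry a factor `1 / μ_g`, which the extra factor `μ_g` undoes. -/
def opForm (μ : ℝ × ℝ) (U V : XE P) : ℝ :=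
  (P.Pr * μ.2 * J (DX vel₁ U * DX vel₁ V + DX vel₂ U * DX vel₂ V) +
    P.Pr / μ.2 * J (DY vel₁ U * DY vel₁ V + DY vel₂ U * DY vel₂ V)) +
  (-μ.2 * J (VAL pres U * DX vel₁ V) - J (VAL pres U * DY vel₂ V)) +
  (μ.2 * (eddyCoeff P μ.2 * J (smag μ.2 0 U * DX small₁ V +
      smag μ.2 2 U * DX small₂ V)) +
    1 / μ.2 * (eddyCoeff P μ.2 * μ.2 * J (smag μ.2 1 U * DY small₁ V +
      smag μ.2 3 U * DY small₂ V))) +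
  (μ.2 * J (VAL vel₁ U * DX vel₁ U * VAL vel₁ V + VAL vel₁ U * DX vel₂ U * VAL vel₂ V) +
    J (VAL vel₂ U * DY vel₁ U * VAL vel₁ V + VAL vel₂ U * DY vel₂ U * VAL vel₂ V)) +
  -(P.Pr * μ.1 * μ.2) * J (VAL temp U * VAL vel₂ V) -
  (-μ.2 * J (VAL pres V * DX vel₁ U) - J (VAL pres V * DY vel₂ U)) +
  (μ.2 * J (DX temp U * DX temp V) + 1 / μ.2 * J (DY temp U * DY temp V)) +
  (μ.2 * J (VAL vel₁ U * DX temp U * VAL temp V) + J (VAL vel₂ U * DY temp U * VAL temp V)) +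
  (μ.2 / P.Pr * (eddyCoeff P μ.2 * J (smagMoll μ.2 U *
      (DX smallTemp U * DX smallTemp V))) +
    1 / (P.Pr * μ.2) * (eddyCoeff P μ.2 * J (smagMoll μ.2 U *
      (DY smallTemp U * DY smallTemp V))))

/-- The operator is linear in the test function. -/
def opLin (μ : ℝ × ℝ) (U : XE P) : XE P →ₗ[ℝ] ℝ where
  toFun V := opForm μ U V
  map_add' V W := by
    simp only [opForm, map_add, mul_add, add_mul]
    ring
  map_smul' c V := by
    simp only [opForm, map_smul, mul_smul_comm, smul_mul_assoc, ← smul_add, smul_eq_mul,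
      RingHom.id_apply]
    ring

lemma locC11_opForm (μ : ℝ × ℝ) (V : XE P) : LocC11 (fun U : XE P => opForm μ U V) := by
  have hL : ∀ L : XE P →ₗ[ℝ] Fld P, LocC11 (fun U => L U) := fun L =>
    L.toContinuousLinearMap.locC11
  have hJ : ∀ f : XE P → Fld P, LocC11 f → LocC11 (fun U => J (f U)) := fun f hf => hf.clm J
  have hc : ∀ (c : ℝ) (f : XE P → ℝ), LocC11 f → LocC11 (fun U => c * f U) := fun c f hf =>
    (locC11_const c).mul hf
  have hmc : ∀ (c : Fld P) (f : XE P → Fld P), LocC11 f → LocC11 (fun U => f U * c) :=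
    fun c f hf => hf.mul (locC11_const c)
  have hcm : ∀ (c : Fld P) (f : XE P → Fld P), LocC11 f → LocC11 (fun U => c * f U) :=
    fun c f hf => (locC11_const c).mul hf
  have hneg : ∀ f : XE P → ℝ, LocC11 f → LocC11 (fun U => -f U) := fun f hf => by
    simpa using hc (-1) f hf
  simp only [opForm, sub_eq_add_neg]
  repeat' first
    | exact hL _
    | exact locC11_smag _ _
    | exact locC11_smagMoll _
    | refine LocC11.add ?_ ?_
    | refine hc _ _ ?_
    | refine hneg _ ?_
    | refine hJ _ ?_
    | refine hmc _ _ ?_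
    | refine hcm _ _ ?_
    | refine LocC11.mul ?_ ?_

lemma field_fst (U : XE P) : (Yh.field U.1).1 = (vel₁ U : Sc) := rfl

lemma field_snd (U : XE P) : (Yh.field U.1).2 = (vel₂ U : Sc) := rfl

lemma temp_coe (U : XE P) : (U.2.1 : Sc) = (temp U : Sc) := rfl

lemma pres_coe (U : XE P) : (U.2.2 : Sc) = (pres U : Sc) := rfl

lemma au_eq (Pr μg : ℝ) (U V : XE P) : au Pr μg (Yh.field U.1) (Yh.field V.1) =
    Pr * μg * J (DX vel₁ U * DX vel₁ V + DX vel₂ U * DX vel₂ V) +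
      Pr / μg * J (DY vel₁ U * DY vel₁ V + DY vel₂ U * DY vel₂ V) := by
  rw [au, setIntegral_cavity_eq (DX vel₁ U * DX vel₁ V + DX vel₂ U * DX vel₂ V),
    setIntegral_cavity_eq (DY vel₁ U * DY vel₁ V + DY vel₂ U * DY vel₂ V)] <;> intro p
  · simp [field_fst, field_snd, dy_eq]
  · simp [field_fst, field_snd, dx_eq]

lemma b_eq (μg : ℝ) (U V : XE P) : b μg (Yh.field U.1) V.2.2 =
    -μg * J (VAL pres V * DX vel₁ U) - J (VAL pres V * DY vel₂ U) := by
  rw [b, setIntegral_cavity_eq (VAL pres V * DX vel₁ U),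
    setIntegral_cavity_eq (VAL pres V * DY vel₂ U)] <;> intro p
  · simp [pres_coe, field_snd, dy_eq, val_eq]
  · simp [pres_coe, field_fst, dx_eq, val_eq]

lemma cu_eq (μg : ℝ) (U V : XE P) :
    cu μg (Yh.field U.1) (Yh.field U.1) (Yh.field V.1) =
    μg * J (VAL vel₁ U * DX vel₁ U * VAL vel₁ V + VAL vel₁ U * DX vel₂ U * VAL vel₂ V) +
      J (VAL vel₂ U * DY vel₁ U * VAL vel₁ V + VAL vel₂ U * DY vel₂ U * VAL vel₂ V) := by
  rw [cu, setIntegral_cavity_eq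
      (VAL vel₁ U * DX vel₁ U * VAL vel₁ V + VAL vel₁ U * DX vel₂ U * VAL vel₂ V),
    setIntegral_cavity_eq
      (VAL vel₂ U * DY vel₁ U * VAL vel₁ V + VAL vel₂ U * DY vel₂ U * VAL vel₂ V)] <;> intro p
  · simp [field_fst, field_snd, dy_eq, val_eq]
  · simp [field_fst, field_snd, dx_eq, val_eq]

lemma buoy_eq (Pr μph μg : ℝ) (U V : XE P) : buoy Pr μph μg U.2.1 (Yh.field V.1) =
    -(Pr * μph * μg) * J (VAL temp U * VAL vel₂ V) := by
  rw [buoy, setIntegral_cavity_eq (VAL temp U * VAL vel₂ V)]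
  intro p
  simp [temp_coe, field_snd, val_eq]

lemma aθ_eq (μg : ℝ) (U V : XE P) : aθ μg U.2.1 V.2.1 =
    μg * J (DX temp U * DX temp V) + 1 / μg * J (DY temp U * DY temp V) := by
  rw [aθ, setIntegral_cavity_eq (DX temp U * DX temp V),
    setIntegral_cavity_eq (DY temp U * DY temp V)] <;> intro p
  · simp [temp_coe, dy_eq]
  · simp [temp_coe, dx_eq]

lemma cθ_eq (μg : ℝ) (U V : XE P) : cθ μg (Yh.field U.1) U.2.1 V.2.1 =
    μg * J (VAL vel₁ U * DX temp U * VAL temp V) + J (VAL vel₂ U * DY temp U * VAL temp V) := by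
  rw [cθ, setIntegral_cavity_eq (VAL vel₁ U * DX temp U * VAL temp V),
    setIntegral_cavity_eq (VAL vel₂ U * DY temp U * VAL temp V)] <;> intro p
  · simp [temp_coe, field_snd, dy_eq, val_eq]
  · simp [temp_coe, field_fst, dx_eq, val_eq]

lemma νT_smallY (μg : ℝ) (U : XE P) (p : P.toMesh.offEdges) :
    P.νT μg (P.smallY U.1) p = eddyCoeff P μg * ‖gradSmall μg U p‖ := by
  rw [Model.νT, gradMod_smallY, eddyCoeff]

lemma νTn_smallY (μg : ℝ) (U : XE P) (p : P.toMesh.offEdges) :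
    P.νTn μg (P.smallY U.1) p = eddyCoeff P μg * smagMoll μg U p := by
  rw [Model.νTn, gradMod_smallY, eddyCoeff, smagMoll_apply]

lemma aSu_eq {μg : ℝ} (hμg : μg ≠ 0) (U V : XE P) : P.aSu μg U.1 U.1 V.1 =
    μg * (eddyCoeff P μg * J (smag μg 0 U * DX small₁ V + smag μg 2 U * DX small₂ V)) +
      1 / μg * (eddyCoeff P μg * μg * J (smag μg 1 U * DY small₁ V +
        smag μg 3 U * DY small₂ V)) := by
  rw [Model.aSu, setIntegral_cavity_eq
      (eddyCoeff P μg • (smag μg 0 U * DX small₁ V + smag μg 2 U * DX small₂ V)),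
    setIntegral_cavity_eq
      ((eddyCoeff P μg * μg) • (smag μg 1 U * DY small₁ V + smag μg 3 U * DY small₂ V)),
    map_smul, map_smul, smul_eq_mul, smul_eq_mul] <;> intro p
  · rw [νT_smallY]
    simp only [smallY_fst, smallY_snd, dy_eq, BoundedContinuousFunction.coe_smul,
      BoundedContinuousFunction.coe_add, BoundedContinuousFunction.coe_mul, Pi.add_apply,
      Pi.mul_apply, smag_apply, smul_eq_mul]
    simp only [gradSmall, LinearMap.comp_apply, assemble_apply, LinearMap.pi_apply]
    simp
    field_simp
  · rw [νT_smallY]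
    simp only [smallY_fst, smallY_snd, dx_eq, BoundedContinuousFunction.coe_smul,
      BoundedContinuousFunction.coe_add, BoundedContinuousFunction.coe_mul, Pi.add_apply,
      Pi.mul_apply, smag_apply, smul_eq_mul]
    simp only [gradSmall, LinearMap.comp_apply, assemble_apply, LinearMap.pi_apply]
    simp
    ring

lemma aSθ_eq (μg : ℝ) (U V : XE P) : P.aSθ μg U.1 U.2.1 V.2.1 =
    μg / P.Pr * (eddyCoeff P μg * J (smagMoll μg U * (DX smallTemp U * DX smallTemp V))) +
      1 / (P.Pr * μg) * (eddyCoeff P μg * J (smagMoll μg U *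
        (DY smallTemp U * DY smallTemp V))) := by
  rw [Model.aSθ, setIntegral_cavity_eq
      (eddyCoeff P μg • (smagMoll μg U * (DX smallTemp U * DX smallTemp V))),
    setIntegral_cavity_eq
      (eddyCoeff P μg • (smagMoll μg U * (DY smallTemp U * DY smallTemp V))),
    map_smul, map_smul, smul_eq_mul, smul_eq_mul] <;> intro p
  · rw [νTn_smallY]
    simp [smallθ_eq, dy_eq, mul_assoc]
  · rw [νTn_smallY]
    simp [smallθ_eq, dx_eq, mul_assoc]

lemma op_eq_opForm {μ : ℝ × ℝ} (hμ : 0 < μ.2) (U V : XE P) : P.A μ U V = opForm μ U V := by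
  unfold Model.A opForm
  rw [au_eq, b_eq, aSu_eq hμ.ne', cu_eq, buoy_eq, b_eq, aθ_eq, cθ_eq, aSθ_eq]

end Operator

end XE

/-! ### Inf-sup and continuity constants -/

section Constants

variable {E : Type*} [NormedAddCommGroup E] [NormedSpace ℝ E]

/-- For maps into a finite-dimensional dual, `C^{1,1}_loc` regularity may be tested pointwise. -/
lemma locC11_of_apply {E' : Type*} [NormedAddCommGroup E'] [NormedSpace ℝ E']
    [FiniteDimensional ℝ E'] {f : E → E' →L[ℝ] ℝ} (h : ∀ V, LocC11 fun U => f U V) :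
    LocC11 f := by
  let b := Module.finBasis ℝ E'
  have hf : f = fun U => ∑ i, ContinuousLinearMap.toSpanSingleton ℝ
      (b.coord i).toContinuousLinearMap (f U (b i)) := by
    funext U
    ext V
    conv_lhs => rw [← b.sum_repr V, map_sum]
    simp [mul_comm]
  rw [hf]
  exact LocC11.sum _ fun i => (h (b i)).clm _

lemma apply_div_le (D : E →L[ℝ] E →L[ℝ] ℝ) (Z V : E) :
    D Z V / (‖Z‖ * ‖V‖) ≤ ‖D Z‖ / ‖Z‖ := by
  rw [← div_div, div_right_comm]
  refine div_le_div_of_nonneg_right ?_ (norm_nonneg _)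
  exact div_le_of_le_mul₀ (norm_nonneg _) (norm_nonneg _)
    ((le_abs_self _).trans ((D Z).le_opNorm V))

lemma apply_div_le_norm (D : E →L[ℝ] E →L[ℝ] ℝ) (Z V : E) :
    D Z V / (‖Z‖ * ‖V‖) ≤ ‖D‖ :=
  (apply_div_le D Z V).trans
    (div_le_of_le_mul₀ (norm_nonneg _) (norm_nonneg D) (D.le_opNorm Z))

lemma neg_norm_le_apply_div (D : E →L[ℝ] E →L[ℝ] ℝ) (Z V : E) :
    -‖D‖ ≤ D Z V / (‖Z‖ * ‖V‖) := by
  have h := apply_div_le_norm D (-Z) V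
  rw [map_neg, neg_apply, norm_neg, neg_div] at h
  linarith

lemma bddAbove_apply_div (D : E →L[ℝ] E →L[ℝ] ℝ) (Z : E) :
    BddAbove (range fun V : {V : E // V ≠ 0} => D Z V / (‖Z‖ * ‖(V : E)‖)) :=
  ⟨‖D‖, by rintro _ ⟨V, rfl⟩; exact apply_div_le_norm D Z V⟩

/-- The inf-sup constant bounds the operator from below. -/
lemma infSup_mul_norm_le (D : E →L[ℝ] E →L[ℝ] ℝ) (Z : E) :
    (⨅ Z : {Z : E // Z ≠ 0}, ⨆ V : {V : E // V ≠ 0}, D Z V / (‖(Z : E)‖ * ‖(V : E)‖)) * ‖Z‖ ≤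
      ‖D Z‖ := by
  rcases eq_or_ne Z 0 with rfl | hZ
  · simp
  rw [← le_div_iff₀ (norm_pos_iff.2 hZ)]
  have : Nonempty {V : E // V ≠ 0} := ⟨⟨Z, hZ⟩⟩
  refine (ciInf_le ⟨-‖D‖, ?_⟩ (⟨Z, hZ⟩ : {Z : E // Z ≠ 0})).trans
    (ciSup_le fun V => apply_div_le D Z V)
  rintro _ ⟨W, rfl⟩
  exact (neg_norm_le_apply_div D W W).trans (le_ciSup (bddAbove_apply_div D W) W)

/-- The continuity constant bounds the operator from above. -/
lemma norm_apply_le_supSup (D : E →L[ℝ] E →L[ℝ] ℝ) (Z V : E) :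
    |D Z V| ≤
      (⨆ Z : {Z : E // Z ≠ 0}, ⨆ V : {V : E // V ≠ 0}, D Z V / (‖(Z : E)‖ * ‖(V : E)‖)) *
        ‖Z‖ * ‖V‖ := by
  have key : ∀ Z : E, D Z V ≤
      (⨆ Z : {Z : E // Z ≠ 0}, ⨆ V : {V : E // V ≠ 0}, D Z V / (‖(Z : E)‖ * ‖(V : E)‖)) *
        ‖Z‖ * ‖V‖ := by
    intro Z
    rcases eq_or_ne Z 0 with rfl | hZ
    · simp
    rcases eq_or_ne V 0 with rfl | hV
    · simp
    have : Nonempty {V : E // V ≠ 0} := ⟨⟨Z, hZ⟩⟩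
    rw [mul_assoc, ← div_le_iff₀ (mul_pos (norm_pos_iff.2 hZ) (norm_pos_iff.2 hV))]
    refine (le_ciSup (bddAbove_apply_div D Z) ⟨V, hV⟩).trans
      (le_ciSup (f := fun Z : {Z : E // Z ≠ 0} => ⨆ V : {V : E // V ≠ 0},
        D Z V / (‖(Z : E)‖ * ‖(V : E)‖)) ⟨‖D‖, ?_⟩ ⟨Z, hZ⟩)
    rintro _ ⟨W, rfl⟩
    exact ciSup_le fun V => apply_div_le_norm D W V
  refine abs_le.2 ⟨?_, key Z⟩
  have h := key (-Z)
  rw [map_neg, neg_apply, norm_neg] at h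
  linarith

lemma apply_le_iSup_mul_norm (ℓ : E →L[ℝ] ℝ) (V : E) :
    |ℓ V| ≤ (⨆ V : {V : E // V ≠ 0}, |ℓ V| / ‖(V : E)‖) * ‖V‖ := by
  rcases eq_or_ne V 0 with rfl | hV
  · simp
  rw [← div_le_iff₀ (norm_pos_iff.2 hV)]
  refine le_ciSup (f := fun V : {V : E // V ≠ 0} => |ℓ V| / ‖(V : E)‖) ⟨‖ℓ‖, ?_⟩ ⟨V, hV⟩
  rintro _ ⟨W, rfl⟩
  exact div_le_of_le_mul₀ (norm_nonneg _) (norm_nonneg _) (ℓ.le_opNorm W)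

end Constants

/-! ### The abstract error estimator -/

section Estimator

variable {E : Type*} [NormedAddCommGroup E] [InnerProductSpace ℝ E] [FiniteDimensional ℝ E]

/-- The Newton-Kantorovich argument for an equation `H U = 0` in a finite-dimensional inner product
space: existence of a solution and bounds for its distance to the approximate solution `U₀`. -/
lemma exists_zero_and_effectivity {H : E → E →L[ℝ] ℝ} (hd : Differentiable ℝ H) {U₀ : E}
    {β γ ρ ε τ Δ : ℝ} (hβ0 : 0 < β) (hρ : 0 < ρ)
    (hβ : ∀ Z, β * ‖Z‖ ≤ ‖fderiv ℝ H U₀ Z‖)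
    (hγ : ∀ Z V, |fderiv ℝ H U₀ Z V| ≤ γ * ‖Z‖ * ‖V‖)
    (hLip : ∀ U, ‖U - U₀‖ ≤ β / ρ → ‖fderiv ℝ H U - fderiv ℝ H U₀‖ ≤ ρ * ‖U - U₀‖)
    (hε0 : 0 ≤ ε) (hε : ∀ V, |H U₀ V| ≤ ε * ‖V‖)
    (hεle : ∀ C, (∀ V, |H U₀ V| ≤ C * ‖V‖) → ε ≤ C)
    (hτ : τ = 4 * ε * ρ / β ^ 2) (hΔ : Δ = β / (2 * ρ) * (1 - √(1 - τ))) (hτ1 : τ ≤ 1) :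
    (∃! U, H U = 0 ∧ ‖U - U₀‖ ≤ Δ) ∧
      ∀ U, H U = 0 → ‖U - U₀‖ ≤ Δ → Δ ≤ (2 * γ / β + τ) * ‖U - U₀‖ := by
  have hτ0 : 0 ≤ τ := by rw [hτ]; positivity
  have hs0 := Real.sqrt_nonneg (1 - τ)
  have hs2 := Real.sq_sqrt (sub_nonneg.2 hτ1)
  have hs1 : √(1 - τ) ≤ 1 := Real.sqrt_le_one.2 (by linarith)
  set s := √(1 - τ)
  have hετ : ε = τ * β ^ 2 / (4 * ρ) := by rw [hτ]; field_simp
  have hΔ0 : 0 ≤ Δ := by rw [hΔ]; exact mul_nonneg (by positivity) (by linarith)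
  have hΔ2 : 2 * ρ * Δ ≤ β := by
    rw [hΔ, show 2 * ρ * (β / (2 * ρ) * (1 - s)) = β * (1 - s) by field_simp]
    nlinarith
  -- `Δ` is the smaller root of this quadratic equation
  have hΔq : ε + ρ * Δ ^ 2 = β * Δ := by
    have h4 : 4 * ρ * (ε + ρ * Δ ^ 2) = 4 * ρ * (β * Δ) := by
      have h5 : 2 * ρ * Δ = β * (1 - s) := by rw [hΔ]; field_simp
      have h6 : 4 * ρ * ε = τ * β ^ 2 := by rw [hετ]; field_simp
      linear_combination h6 + (2 * ρ * Δ + β * (1 - s) - 2 * β) * h5 + β ^ 2 * hs2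
    exact mul_left_cancel₀ (by positivity) h4
  have hΔr : Δ ≤ β / ρ := by rw [le_div_iff₀ hρ]; nlinarith
  have hΔε : β * Δ ≤ 2 * ε := by
    have h6 : 4 * ρ * ε = τ * β ^ 2 := by rw [hετ]; field_simp
    have h5 : 2 * ρ * Δ = β * (1 - s) := by rw [hΔ]; field_simp
    have h7 : 1 - s ≤ τ := by nlinarith
    have h8 : 2 * ρ * (β * Δ) ≤ 2 * ρ * (2 * ε) := by
      calc 2 * ρ * (β * Δ) = β ^ 2 * (1 - s) := by linear_combination β * h5
        _ ≤ β ^ 2 * τ := by gcongr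
        _ = 2 * ρ * (2 * ε) := by linear_combination -h6
    exact le_of_mul_le_mul_left h8 (by positivity)
  constructor
  -- existence from the contraction principle, uniqueness because `Δ ≤ β / ρ`
  · obtain ⟨U, hU, hHU⟩ := exists_zero_of_newton hd hβ0 hρ hβ hLip
      (ContinuousLinearMap.opNorm_le_bound _ hε0 hε) hΔ0 hΔq hΔ2
    refine ⟨U, ⟨hHU, hU⟩, fun W hW => ?_⟩
    exact eq_of_apply_eq_of_norm_sub_le hd hρ hβ hLip (hW.2.trans hΔr) (hU.trans hΔr)
      (hW.1.trans hHU.symm)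
  -- the residual at `U₀` is bounded by the error, so `ε ≤ γ ‖U - U₀‖ + ρ ‖U - U₀‖²`
  · intro U hHU hU
    have hlin := norm_sub_sub_fderiv_le hd hρ.le hLip (hU.trans hΔr) le_rfl
      (by simp : ‖U₀ - U₀‖ ≤ ‖U - U₀‖)
    have hεE : ε ≤ γ * ‖U - U₀‖ + ρ * ‖U - U₀‖ * ‖U - U₀‖ := by
      refine hεle _ fun V => ?_
      have h1 : H U₀ V = -(fderiv ℝ H U₀ (U - U₀) V) -
          (H U - H U₀ - fderiv ℝ H U₀ (U - U₀)) V := by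
        simp only [sub_apply, hHU, zero_apply]; ring
      rw [h1, add_mul]
      refine (abs_sub _ _).trans (add_le_add ?_ ?_)
      · rw [abs_neg]; exact hγ _ _
      · exact ((H U - H U₀ - fderiv ℝ H U₀ (U - U₀)).le_opNorm V).trans (by gcongr)
    have hE := norm_nonneg (U - U₀)
    have h2 : β * ‖U - U₀‖ ≤ 2 * ε := (mul_le_mul_of_nonneg_left hU hβ0.le).trans hΔε
    have h3 : 2 * ρ * (β * ‖U - U₀‖) ≤ τ * β ^ 2 := by
      calc 2 * ρ * (β * ‖U - U₀‖) ≤ 2 * ρ * (2 * ε) := by gcongr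
        _ = τ * β ^ 2 := by rw [hετ]; field_simp; ring
    have h4 : 2 * ρ * ‖U - U₀‖ ≤ τ * β := by
      refine le_of_mul_le_mul_left (a := β) ?_ hβ0
      linarith
    refine le_of_mul_le_mul_left (a := β) ?_ hβ0
    calc β * Δ ≤ 2 * (γ * ‖U - U₀‖ + ρ * ‖U - U₀‖ * ‖U - U₀‖) := by linarith
      _ = 2 * γ * ‖U - U₀‖ + 2 * ρ * ‖U - U₀‖ * ‖U - U₀‖ := by ring
      _ ≤ 2 * γ * ‖U - U₀‖ + τ * β * ‖U - U₀‖ := by gcongr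
      _ = β * ((2 * γ / β + τ) * ‖U - U₀‖) := by field_simp

end Estimator

/-! ### The error estimator of the discrete problem -/

namespace XE

variable {P : Model}

/-- The operator of the discrete problem as a map into the dual space. -/
def op (μ : ℝ × ℝ) (U : XE P) : XE P →L[ℝ] ℝ := (opLin μ U).toContinuousLinearMap

lemma op_apply {μ : ℝ × ℝ} (hμ : 0 < μ.2) (U V : XE P) : op μ U V = P.A μ U V :=
  (op_eq_opForm hμ U V).symm

lemma locC11_op (μ : ℝ × ℝ) : LocC11 (op (P := P) μ) :=
  locC11_of_apply fun V => locC11_opForm μ V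

/-- The right-hand side of the discrete problem as an element of the dual space. -/
def load (μ : ℝ × ℝ) : XE P →L[ℝ] ℝ :=
  LinearMap.toContinuousLinearMap
    { toFun := fun V => P.rhs μ V
      map_add' := fun V W => by
        change P.F μ (V.1 + W.1) + P.Q μ (V.2.1 + W.2.1) =
          (P.F μ V.1 + P.Q μ V.2.1) + (P.F μ W.1 + P.Q μ W.2.1)
        rw [map_add, map_add]
        ring
      map_smul' := fun c V => by
        change P.F μ (c • V.1) + P.Q μ (c • V.2.1) = c * (P.F μ V.1 + P.Q μ V.2.1)
        rw [map_smul, map_smul, smul_eq_mul, smul_eq_mul, mul_add] }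

lemma load_apply (μ : ℝ × ℝ) (V : XE P) : load μ V = P.rhs μ V := rfl

lemma isFESolution_iff {μ : ℝ × ℝ} (hμ : 0 < μ.2) (U : XE P) :
    P.IsFESolution μ U ↔ op μ U - load μ = 0 := by
  rw [sub_eq_zero, ContinuousLinearMap.ext_iff]
  refine forall_congr' fun V => ?_
  rw [← op_apply hμ U V, ← load_apply μ V]

lemma hasFDerivAt_A {μ : ℝ × ℝ} (hμ : 0 < μ.2) (U V : XE P) :
    HasFDerivAt (fun W : XE P => P.A μ W V)
      ((ContinuousLinearMap.apply ℝ ℝ V).comp (fderiv ℝ (op μ) U)) U := by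
  have h := (ContinuousLinearMap.apply ℝ ℝ V).hasFDerivAt.comp U
    ((locC11_op (P := P) μ).1 U).hasFDerivAt
  refine h.congr_of_eventuallyEq (Filter.Eventually.of_forall fun W => ?_)
  exact (op_apply hμ W V).symm

lemma dA_eq {μ : ℝ × ℝ} (hμ : 0 < μ.2) (U V Z : XE P) :
    P.dA μ U V Z = fderiv ℝ (op μ) U Z V :=
  ((hasFDerivAt_A hμ U V).hasLineDerivAt Z).lineDeriv

lemma βN_eq {μ : ℝ × ℝ} (hμ : 0 < μ.2) (U : XE P) :
    P.βN μ U = ⨅ Z : {Z : XE P // Z ≠ 0}, ⨆ V : {V : XE P // V ≠ 0},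
      fderiv ℝ (op μ) U Z V / (‖(Z : XE P)‖ * ‖(V : XE P)‖) := by
  simp only [← dA_eq hμ, norm_eq_normX]
  rfl

lemma γN_eq {μ : ℝ × ℝ} (hμ : 0 < μ.2) (U : XE P) :
    P.γN μ U = ⨆ Z : {Z : XE P // Z ≠ 0}, ⨆ V : {V : XE P // V ≠ 0},
      fderiv ℝ (op μ) U Z V / (‖(Z : XE P)‖ * ‖(V : XE P)‖) := by
  simp only [← dA_eq hμ, norm_eq_normX]
  rfl

lemma εN_eq {μ : ℝ × ℝ} (hμ : 0 < μ.2) (U : XE P) :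
    P.εN μ U = ⨆ V : {V : XE P // V ≠ 0},
      |(op μ U - load μ : XE P →L[ℝ] ℝ) V| / ‖(V : XE P)‖ := by
  simp only [sub_apply, op_apply hμ, load_apply, norm_eq_normX]
  rfl

lemma isLipschitzConstant_iff {μ : ℝ × ℝ} (hμ : 0 < μ.2) (UN : XE P) (ρ : ℝ) :
    P.IsLipschitzConstant μ UN ρ ↔ 0 < ρ ∧ ∀ U₁ U₂ : XE P, ‖U₁ - UN‖ ≤ P.βN μ UN / ρ →
      ‖U₂ - UN‖ ≤ P.βN μ UN / ρ →
      ‖fderiv ℝ (op μ) U₁ - fderiv ℝ (op μ) U₂‖ ≤ ρ * ‖U₁ - U₂‖ := by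
  have h : P.IsLipschitzConstant μ UN ρ ↔ 0 < ρ ∧ ∀ U₁ U₂ : XE P, ‖U₁ - UN‖ ≤ P.βN μ UN / ρ →
      ‖U₂ - UN‖ ≤ P.βN μ UN / ρ → ∀ Z V : XE P,
      |fderiv ℝ (op μ) U₁ Z V - fderiv ℝ (op μ) U₂ Z V| ≤ ρ * ‖U₁ - U₂‖ * ‖Z‖ * ‖V‖ := by
    simp only [← dA_eq hμ, norm_eq_normX]
    rfl
  rw [h]
  refine and_congr_right fun hρ => forall₄_congr fun U₁ U₂ _ _ => ⟨fun hb => ?_, fun hb Z V => ?_⟩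
  · exact ContinuousLinearMap.opNorm_le_bound₂ _ (by positivity) hb
  · exact (ContinuousLinearMap.le_opNorm₂ (fderiv ℝ (op μ) U₁ - fderiv ℝ (op μ) U₂) Z V).trans
      (by gcongr)

lemma exists_isLipschitzConstant {μ : ℝ × ℝ} (hμ : 0 < μ.2) (UN : XE P) (hβ : 0 < P.βN μ UN) :
    ∃ ρ, P.IsLipschitzConstant μ UN ρ := by
  obtain ⟨K, t, ht, hK⟩ := (locC11_op (P := P) μ).2 UN
  obtain ⟨r, hr, hrt⟩ := Metric.mem_nhds_iff.1 ht
  -- the constant is taken so large that the ball of radius `β / ρ` lies in the neighbourhood `t`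
  refine ⟨K + 2 * P.βN μ UN / r, (isLipschitzConstant_iff hμ UN _).2 ⟨by positivity, ?_⟩⟩
  have hmem : ∀ U : XE P, ‖U - UN‖ ≤ P.βN μ UN / (K + 2 * P.βN μ UN / r) → U ∈ t := by
    intro U hU
    refine hrt (mem_ball_iff_norm.2 (hU.trans_lt ?_))
    rw [div_lt_iff₀ (by positivity), mul_add, mul_div_cancel₀ _ hr.ne']
    nlinarith [mul_nonneg hr.le K.2]
  intro U₁ U₂ h1 h2
  have h := hK.dist_le_mul U₁ (hmem U₁ h1) U₂ (hmem U₂ h2)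
  rw [dist_eq_norm, dist_eq_norm] at h
  refine h.trans (mul_le_mul_of_nonneg_right ?_ (norm_nonneg _))
  have : 0 ≤ 2 * P.βN μ UN / r := by positivity
  linarith

/-- In the zero space the infimum over the empty set would make `β_N` zero. -/
lemma nontrivial_of_βN_pos {μ : ℝ × ℝ} {UN : XE P} (hβ : 0 < P.βN μ UN) :
    Nonempty {V : XE P // V ≠ 0} := by
  by_contra h
  rw [not_nonempty_iff] at h
  have h' : IsEmpty {Z : Xh P.toDiscretization // Z ≠ 0} := h
  have h0 : P.βN μ UN = 0 := Real.iInf_of_isEmpty _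
  exact hβ.ne' h0

/-- The assertions of the theorem, in the normed space `XE P`. -/
lemma errorEstimator {μ : ℝ × ℝ} (hμ : 0 < μ.2) (UN : XE P) (hβ : 0 < P.βN μ UN) {ρ : ℝ}
    (hρ : P.IsLipschitzConstant μ UN ρ) :
    (∀ Uh : XE P, P.IsFESolution μ Uh → ‖Uh - UN‖ ≤ P.βN μ UN / ρ →
      ∀ Wh : XE P, P.IsFESolution μ Wh → ‖Wh - UN‖ ≤ P.βN μ UN / ρ → Wh = Uh) ∧
    (P.τN μ UN ρ ≤ 1 →
      (∃! Uh : XE P, P.IsFESolution μ Uh ∧ ‖Uh - UN‖ ≤ P.ΔN μ UN ρ) ∧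
      ∀ Uh : XE P, P.IsFESolution μ Uh → ‖Uh - UN‖ ≤ P.ΔN μ UN ρ →
        P.ΔN μ UN ρ ≤ (2 * P.γN μ UN / P.βN μ UN + P.τN μ UN ρ) * ‖Uh - UN‖) := by
  obtain ⟨hρ0, hρL⟩ := (isLipschitzConstant_iff hμ UN ρ).1 hρ
  have hd : Differentiable ℝ fun U : XE P => op μ U - load μ :=
    (locC11_op (P := P) μ).1.sub_const _
  have hfd : ∀ U : XE P, fderiv ℝ (fun U : XE P => op μ U - load μ) U = fderiv ℝ (op μ) U :=
    fun U => fderiv_sub_const _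
  have hβ' : ∀ Z : XE P,
      P.βN μ UN * ‖Z‖ ≤ ‖fderiv ℝ (fun U : XE P => op μ U - load μ) UN Z‖ := by
    intro Z
    rw [hfd, βN_eq hμ]
    exact infSup_mul_norm_le _ Z
  have hLip : ∀ U : XE P, ‖U - UN‖ ≤ P.βN μ UN / ρ →
      ‖fderiv ℝ (fun U : XE P => op μ U - load μ) U -
        fderiv ℝ (fun U : XE P => op μ U - load μ) UN‖ ≤ ρ * ‖U - UN‖ := by
    intro U hU
    rw [hfd, hfd]
    exact hρL U UN hU (by rw [sub_self, norm_zero]; positivity)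
  simp only [isFESolution_iff hμ]
  constructor
  · intro Uh hUh hUb Wh hWh hWb
    exact eq_of_apply_eq_of_norm_sub_le hd hρ0 hβ' hLip hWb hUb (hWh.trans hUh.symm)
  · intro hτ
    have := nontrivial_of_βN_pos hβ
    refine exists_zero_and_effectivity hd (ε := P.εN μ UN) hβ hρ0 hβ' (fun Z V => ?_) hLip
      ?_ (fun V => ?_) (fun C hC => ?_) rfl rfl hτ
    · rw [hfd, γN_eq hμ]
      exact norm_apply_le_supSup _ Z V
    · rw [εN_eq hμ]
      exact Real.iSup_nonneg fun V => by positivity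
    · rw [εN_eq hμ]
      exact apply_le_iSup_mul_norm _ V
    · rw [εN_eq hμ]
      exact ciSup_le fun V => (div_le_iff₀ (norm_pos_iff.2 V.2)).2 (hC V)

end XE

end NatConv

end

theorem mainTheorem1 (P : NatConv.Model)
    -- the parameter `μ = (μ_ph, μ_g)`
    (μ : ℝ × ℝ) (hμ : 0 < μ.2)
    -- the snapshots: finite element solutions for parameters `μs k`
    {N : ℕ} (μs : Fin N → ℝ × ℝ) (hμs : ∀ k, 0 < (μs k).2)
    (S : Fin N → NatConv.Xh P.toDiscretization) (hS : ∀ k, P.IsFESolution (μs k) (S k))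
    -- the reduced basis solution
    (UN : NatConv.Xh P.toDiscretization) (hUN : P.IsRBSolution μ S UN)
    (hβ : 0 < P.βN μ UN) :
    -- the derivative exists, and so do Lipschitz constants `ρ_n`
    (∀ U V Z, LineDifferentiableAt ℝ (fun W => P.A μ W V) U Z) ∧
    (∃ ρ, P.IsLipschitzConstant μ UN ρ) ∧
    ∀ ρ, P.IsLipschitzConstant μ UN ρ →
      -- a solution in the ball of radius `β_N / ρ_n` is the only one there
      (∀ Uh, P.IsFESolution μ Uh → P.normX (Uh - UN) ≤ P.βN μ UN / ρ →
        ∀ Wh, P.IsFESolution μ Wh → P.normX (Wh - UN) ≤ P.βN μ UN / ρ → Wh = Uh) ∧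
      -- error bound and effectivity
      (P.τN μ UN ρ ≤ 1 →
        (∃! Uh, P.IsFESolution μ Uh ∧ P.normX (Uh - UN) ≤ P.ΔN μ UN ρ) ∧
        ∀ Uh, P.IsFESolution μ Uh → P.normX (Uh - UN) ≤ P.ΔN μ UN ρ →
          P.ΔN μ UN ρ ≤
            (2 * P.γN μ UN / P.βN μ UN + P.τN μ UN ρ) * P.normX (Uh - UN)) := by
  refine ⟨fun U V Z => ((NatConv.XE.hasFDerivAt_A hμ U V).hasLineDerivAt Z).lineDifferentiableAt,
    NatConv.XE.exists_isLipschitzConstant hμ UN hβ, fun ρ hρ => ?_⟩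
  have h := NatConv.XE.errorEstimator hμ UN hβ hρ
  simp only [NatConv.XE.norm_eq_normX] at h
  exact h
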